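/- Let $P_n=\{z\in\mathbb C^n: |z^l|<1,\ l=1,\dots,n\}$ be the unit polydisk, $n\ge 2$. For $t\in[0,\infty)$ and an integer $k\ge 2$ define, for $z\in P_n$ and $v\in T^{1,0}_zP_n\cong\mathbb C^n$, $$F_{t,k}(z,v)=\frac1{\sqrt{1+t}}\sqrt{\sum_{l=1}^n\frac{|v^l|^2}{(1-|z^l|^2)^2}+t\sqrt[k]{\sum_{l=1}^n\frac{|v^l|^{2k}}{(1-|z^l|^2)^{2k}}}} .$$ Terminology, for a complex Finsler metric $F$ with $G=F^2$ on an open set $D\subset\mathbb C^n$. $F$ is *strongly pseudoconvex* if $F$ is continuous and nonnegative, vanishes exactly at $v=0$, $G$ is $C^\infty$ for $v\ne0$, $G(z,\lambda v)=|\lambda|^2G(z,v)$ for $\lambda\in\mathbb C$, and $(G_{\alpha\bar\beta})=(\partial^2G/\partial v^\alpha\partial\bar v^\beta)$ is positive definite for $v\neq0$; it is *strongly convex* if moreover the real Hessian $(\frac12\partial^2G/\partial u^a\partial u^b)$, $v^\alpha=u^\alpha+iu^{\alpha+n}$, is positive definite for $v\ne 0$. Put $\Gamma^\alpha_{;\mu}=\sum_\tau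 G^{\bar\tau\alpha}\,\partial^2G/\partial\bar v^\tau\partial z^\mu$, where $(G^{\bar\tau\alpha})$ is the inverse matrix of $(G_{\alpha\bar\beta})$, and $\Gamma^\alpha_{\nu;\mu}=\partial\Gamma^\alpha_{;\mu}/\partial v^\nu$. $F$ is *Kähler-Berwald* if it is strongly pseudoconvex, $\sum_\nu(\Gamma^\alpha_{\nu;\mu}-\Gamma^\alpha_{\mu;\nu})v^\nu=0$ for all $\alpha,\mu$ and $v\neq 0$, and the $\Gamma^\alpha_{\nu;\mu}$ do not depend on $v$. Its *holomorphic sectional curvature* along $v\ne0$ is $$K_F(z,v)=-\frac2{G^2}\sum_{\gamma,\alpha,\mu}\frac{\partial G}{\partial v^\gamma}\,\delta_{\bar\mu}(\Gamma^\gamma_{;\alpha})\,v^\alpha\overline{v^\mu},\qquad \delta_{\bar\mu}=\frac{\partial}{\partial\bar z^\mu}-\sum_\kappa\overline{\Gamma^\kappa_{;\mu}}\frac{\partial}{\partial\bar v^\kappa}.$$ The distance of $F$ is the infimum of the $F$-lengths of the $C^1$ curves in $D$ that join two points, and $F$ is *complete* if this distance is. The *geodesics* of $F$ are the regular $C^2$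 curves that satisfy the Euler-Lagrange equations of the energy $\int G(\gamma,\gamma')\,ds$. The Bergman metric of $P_n$ is normalized as $F_0^2=\sum_{l}|dz^l|^2/(1-|z^l|^2)^2$. **Theorem.** (1) $F_{t,k}$ is an $\mathrm{Aut}(P_n)$-invariant complete strongly convex Kähler-Berwald metric on $P_n$, and for all $z\in P_n$ and $v\ne0$ its holomorphic sectional curvature is real and satisfies $$-4\le K_{F_{t,k}}(z,v)\le-\frac{4(1+t)}{n+t\sqrt[k]{n}} .$$ (2) $F_{t,k}$ has the same geodesics as the Bergman metric of $P_n$, and the distance of $Z_1=(z_1^1,\dots,z_1^n)$ and $Z_2=(z_2^1,\dots,z_2^n)$ in $P_n$ with respect to $F_{t,k}$ is $$\sigma(Z_1,Z_2)=\frac1{2\sqrt{1+t}}\sqrt{\sum_{l=1}^n L_l^{2}+t\sqrt[k]{\sum_{l=1}^nL_l^{2k}}},\qquad L_l=\log\frac{1+\left|\frac{z_2^l-z_1^l}{1-\overline{z_1^l}z_2^l}\right|}{1-\left|\frac{z_2^l-z_1^l}{1-\overline{z_1^l}z_2^l}\right|} .$$ -/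

import Mathlib

open scoped ContDiff ComplexConjugate ComplexOrder

noncomputable section

namespace ComplexFinsler

/-! Complex Finsler geometry on an open set `D` of `ℂⁿ`. Its holomorphic tangent bundle is
`D × ℂⁿ` with the global holomorphic coordinates `(z, v)`, and a complex Finsler metric is a
function `F : ℂⁿ → ℂⁿ → ℝ`, of which only the values `F z v` with `z ∈ D` matter. -/

variable {n : ℕ}

/-- The Wirtinger derivative `∂f/∂z^α = ½ (∂f/∂x^α - i ∂f/∂y^α)` at `p`. -/
def dz (α : Fin n) (f : (Fin n → ℂ) → ℂ) (p : Fin n → ℂ) : ℂ :=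
  (fderiv ℝ f p (Pi.single α 1) - Complex.I * fderiv ℝ f p (Pi.single α Complex.I)) / 2

/-- The Wirtinger derivative `∂f/∂z̄^α = ½ (∂f/∂x^α + i ∂f/∂y^α)` at `p`. -/
def dzbar (α : Fin n) (f : (Fin n → ℂ) → ℂ) (p : Fin n → ℂ) : ℂ :=
  (fderiv ℝ f p (Pi.single α 1) + Complex.I * fderiv ℝ f p (Pi.single α Complex.I)) / 2

/-- `G = F²`. -/
def energy (F : (Fin n → ℂ) → (Fin n → ℂ) → ℝ) (z v : Fin n → ℂ) : ℝ := F z v ^ 2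

/-- `G = F²`, as a complex number. -/
def energyC (F : (Fin n → ℂ) → (Fin n → ℂ) → ℝ) (z v : Fin n → ℂ) : ℂ := (energy F z v : ℂ)

/-- The matrix `(G_{α β̄}) = (∂²G / ∂v^α ∂v̄^β)`. -/
def leviMatrix (F : (Fin n → ℂ) → (Fin n → ℂ) → ℝ) (z v : Fin n → ℂ) :
    Matrix (Fin n) (Fin n) ℂ :=
  Matrix.of fun α β => dz α (fun w => dzbar β (energyC F z) w) v

/-- A strongly pseudoconvex complex Finsler metric on `D`. -/
structure IsStronglyPseudoconvex (D : Set (Fin n → ℂ))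
    (F : (Fin n → ℂ) → (Fin n → ℂ) → ℝ) : Prop where
  continuousOn : ContinuousOn (fun p : (Fin n → ℂ) × (Fin n → ℂ) => F p.1 p.2) (D ×ˢ Set.univ)
  nonneg : ∀ z ∈ D, ∀ v, 0 ≤ F z v
  eq_zero_iff : ∀ z ∈ D, ∀ v, F z v = 0 ↔ v = 0
  smooth : ContDiffOn ℝ ∞ (fun p : (Fin n → ℂ) × (Fin n → ℂ) => energy F p.1 p.2) (D ×ˢ {0}ᶜ)
  homogeneous : ∀ z ∈ D, ∀ (c : ℂ) (v : Fin n → ℂ), energy F z (c • v) = ‖c‖ ^ 2 * energy F z v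
  posDef : ∀ z ∈ D, ∀ v, v ≠ 0 → (leviMatrix F z v).PosDef

/-- The real coordinate vectors `∂/∂u^α` and `∂/∂u^{n+α}` of `ℂⁿ`, `v^α = u^α + i u^{n+α}`. -/
def realBasisVec : Fin n ⊕ Fin n → (Fin n → ℂ)
  | Sum.inl α => Pi.single α 1
  | Sum.inr α => Pi.single α Complex.I

/-- The real fundamental tensor `(g_{ab}) = (½ ∂²G / ∂u^a ∂u^b)`. -/
def fundamentalMatrix (F : (Fin n → ℂ) → (Fin n → ℂ) → ℝ) (z v : Fin n → ℂ) :
    Matrix (Fin n ⊕ Fin n) (Fin n ⊕ Fin n) ℝ :=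
  Matrix.of fun a b =>
    (1 / 2) * fderiv ℝ (fun w => fderiv ℝ (energy F z) w (realBasisVec b)) v (realBasisVec a)

/-- A strongly convex complex Finsler metric. -/
def IsStronglyConvex (D : Set (Fin n → ℂ)) (F : (Fin n → ℂ) → (Fin n → ℂ) → ℝ) : Prop :=
  IsStronglyPseudoconvex D F ∧ ∀ z ∈ D, ∀ v, v ≠ 0 → (fundamentalMatrix F z v).PosDef

/-- The Chern-Finsler non-linear connection coefficients
`Γ^α_{;μ} = ∑_τ G^{τ̄ α} ∂²G / ∂v̄^τ ∂z^μ`. -/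
def chernFinsler (F : (Fin n → ℂ) → (Fin n → ℂ) → ℝ) (α μ : Fin n) (z v : Fin n → ℂ) : ℂ :=
  ∑ τ, (leviMatrix F z v)⁻¹ τ α * dzbar τ (fun w => dz μ (fun y => energyC F y w) z) v

/-- The horizontal Chern-Finsler connection coefficients `Γ^α_{ν;μ} = ∂Γ^α_{;μ} / ∂v^ν`. -/
def horizontalChernFinsler (F : (Fin n → ℂ) → (Fin n → ℂ) → ℝ) (α ν μ : Fin n)
    (z v : Fin n → ℂ) : ℂ :=
  dz ν (fun w => chernFinsler F α μ z w) v

/-- The Kähler-Finsler condition `(Γ^α_{ν;μ} - Γ^α_{μ;ν}) v^ν = 0`. -/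
def IsKahlerFinsler (D : Set (Fin n → ℂ)) (F : (Fin n → ℂ) → (Fin n → ℂ) → ℝ) : Prop :=
  IsStronglyPseudoconvex D F ∧ ∀ z ∈ D, ∀ v, v ≠ 0 → ∀ α μ,
    ∑ ν, (horizontalChernFinsler F α ν μ z v - horizontalChernFinsler F α μ ν z v) * v ν = 0

/-- Complex Berwald metrics: the `Γ^α_{ν;μ}` do not depend on the fiber coordinates. -/
def IsComplexBerwald (D : Set (Fin n → ℂ)) (F : (Fin n → ℂ) → (Fin n → ℂ) → ℝ) : Prop :=
  IsStronglyPseudoconvex D F ∧ ∀ z ∈ D, ∀ v w, v ≠ 0 → w ≠ 0 → ∀ α ν μ,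
    horizontalChernFinsler F α ν μ z v = horizontalChernFinsler F α ν μ z w

/-- Kähler-Berwald metrics. -/
def IsKahlerBerwald (D : Set (Fin n → ℂ)) (F : (Fin n → ℂ) → (Fin n → ℂ) → ℝ) : Prop :=
  IsKahlerFinsler D F ∧ IsComplexBerwald D F

/-- The horizontal derivative `δ_{μ̄} = ∂/∂z̄^μ - ∑_κ conj(Γ^κ_{;μ}) ∂/∂v̄^κ` of a function
`H` of `(z, v)`. -/
def deltaBar (F : (Fin n → ℂ) → (Fin n → ℂ) → ℝ) (μ : Fin n)
    (H : (Fin n → ℂ) → (Fin n → ℂ) → ℂ) (z v : Fin n → ℂ) : ℂ :=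
  dzbar μ (fun y => H y v) z - ∑ κ, conj (chernFinsler F κ μ z v) * dzbar κ (fun w => H z w) v

/-- The holomorphic sectional curvature
`K(z, v) = -(2 / G²) ∑ G_γ δ_{μ̄}(Γ^γ_{;α}) v^α v̄^μ` (a complex expression with real value). -/
def holSectCurvature (F : (Fin n → ℂ) → (Fin n → ℂ) → ℝ) (z v : Fin n → ℂ) : ℂ :=
  -(2 / energyC F z v ^ 2) * ∑ γ, ∑ α, ∑ μ,
    dz γ (energyC F z) v * deltaBar F μ (fun y w => chernFinsler F γ α y w) z v
      * v α * conj (v μ)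

/-- `f` restricts to a holomorphic automorphism of the open set `D`. -/
def IsAut (D : Set (Fin n → ℂ)) (f : (Fin n → ℂ) → (Fin n → ℂ)) : Prop :=
  ∃ g : (Fin n → ℂ) → (Fin n → ℂ), Set.MapsTo f D D ∧ Set.MapsTo g D D ∧ Set.InvOn g f D D ∧
    DifferentiableOn ℂ f D ∧ DifferentiableOn ℂ g D

/-- `F(f(z), f_* v) = F(z, v)` for all `f` in `Aut(D)`. -/
def IsAutInvariant (D : Set (Fin n → ℂ)) (F : (Fin n → ℂ) → (Fin n → ℂ) → ℝ) : Prop :=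
  ∀ f, IsAut D f → ∀ z ∈ D, ∀ v, F (f z) (fderiv ℂ f z v) = F z v

/-- `γ : [0, 1] → D` is a curve of class `C¹` from `p` to `q`. -/
def IsCurve (D : Set (Fin n → ℂ)) (p q : Fin n → ℂ) (γ : ℝ → (Fin n → ℂ)) : Prop :=
  ContDiffOn ℝ 1 γ (Set.Icc 0 1) ∧ Set.MapsTo γ (Set.Icc 0 1) D ∧ γ 0 = p ∧ γ 1 = q

/-- The `F`-length of a curve `[0, 1] → D`. -/
def curveLength (F : (Fin n → ℂ) → (Fin n → ℂ) → ℝ) (γ : ℝ → (Fin n → ℂ)) : ℝ :=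
  ∫ s in (0 : ℝ)..1, F (γ s) (derivWithin γ (Set.Icc 0 1) s)

/-- The distance of `F` on a connected open set `D`: the infimum of the lengths of the curves
in `D` that join two points. -/
def finslerDist (D : Set (Fin n → ℂ)) (F : (Fin n → ℂ) → (Fin n → ℂ) → ℝ)
    (p q : Fin n → ℂ) : ℝ :=
  sInf (curveLength F '' {γ | IsCurve D p q γ})

/-- `F` is complete: every Cauchy sequence for its distance converges for its distance. -/
def IsFinslerComplete (D : Set (Fin n → ℂ)) (F : (Fin n → ℂ) → (Fin n → ℂ) → ℝ) : Prop :=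
  ∀ u : ℕ → (Fin n → ℂ), (∀ i, u i ∈ D) →
    (∀ ε > 0, ∃ N, ∀ i ≥ N, ∀ j ≥ N, finslerDist D F (u i) (u j) < ε) →
    ∃ p ∈ D, Filter.Tendsto (fun i => finslerDist D F (u i) p) Filter.atTop (nhds 0)

/-- `γ` is a (non-constant, affinely parametrized) geodesic of `F` on the interval `I`: it is a
regular `C²` curve in `D` that satisfies the Euler-Lagrange equations
`d/ds (∂G/∂u^a (γ, γ')) = ∂G/∂x^a (γ, γ')` of the energy `∫ G(γ, γ') ds`, where
`(x^a, u^a)` are the real coordinates of the tangent bundle. -/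
def IsGeodesicOn (D : Set (Fin n → ℂ)) (F : (Fin n → ℂ) → (Fin n → ℂ) → ℝ)
    (I : Set ℝ) (γ : ℝ → (Fin n → ℂ)) : Prop :=
  ContDiffOn ℝ 2 γ I ∧ Set.MapsTo γ I D ∧ (∀ s ∈ I, derivWithin γ I s ≠ 0) ∧
    ∀ s ∈ I, ∀ a : Fin n ⊕ Fin n,
      HasDerivWithinAt
        (fun r => fderiv ℝ (fun w => energy F (γ r) w) (derivWithin γ I r) (realBasisVec a))
        (fderiv ℝ (fun y => energy F y (derivWithin γ I s)) (γ s) (realBasisVec a)) I s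

/-- The unit polydisk in `ℂⁿ`. -/
def polydisk (n : ℕ) : Set (Fin n → ℂ) := {z | ∀ l, ‖z l‖ < 1}

/-- The metric `F_{t,k}` on the unit polydisk. -/
def polydiskMetric (n : ℕ) (t : ℝ) (k : ℕ) (z v : Fin n → ℂ) : ℝ :=
  1 / √(1 + t) *
    √(∑ l, ‖v l‖ ^ 2 / (1 - ‖z l‖ ^ 2) ^ 2 +
      t * (∑ l, ‖v l‖ ^ (2 * k) / (1 - ‖z l‖ ^ 2) ^ (2 * k)) ^ ((1 : ℝ) / k))

/-- The Bergman metric of the unit polydisk, normalized so that its square is the sum of the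
Poincaré metrics `|dz^l|² / (1 - |z^l|²)²` of the factors. -/
def bergmanMetric (n : ℕ) (z v : Fin n → ℂ) : ℝ :=
  √(∑ l, ‖v l‖ ^ 2 / (1 - ‖z l‖ ^ 2) ^ 2)

end ComplexFinsler

end

/-! The energy is `G = φ(a_1, …, a_n)`, where `a_l = |v^l|² / (1 - |z^l|²)²` is the squared Poincaré
norm of the `l`-th component and `φ` is `profile`. On the nonnegative orthant without the origin,
`φ` is symmetric, homogeneous of degree one, has partial derivatives `φ_l` bounded below by `1 / (1
+ t)`, and is convex. Nearly everything follows from these four facts. Convexity and `φ_l > 0` make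
the Levi form and the real Hessian positive definite: each is a nonnegative term from the Hessian of
`φ` plus a positive diagonal form. Since `∂a_l/∂z^l` is `2 z̄^l / (1 - |z^l|²)` times `v^l
∂a_l/∂v^l`, the Chern-Finsler connection is that of the product of Poincaré metrics, whatever `φ` is
(`chernFinsler_polydiskMetric`). Hence the Kähler-Berwald property, and the curvature is `-4 (∑ φ_l
a_l²) / φ²`. Euler's identity `∑ φ_l a_l = φ` with `a_l ≤ φ` bounds it below; power means and
Cauchy-Schwarz bound it above. Invariance needs no classification of the automorphisms. The Schwarz
lemma for `f` and its inverse makes the differential, in Poincaré-normalized coordinates, a linear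
isometry for the supremum norm; such a map permutes the moduli of the coordinates
(`exists_perm_of_norm_le`), and `φ` is symmetric. For geodesics, the Euler-Lagrange equations imply
that every `a_l` is constant along the curve, by convexity of `φ`
(`eq_zero_of_profileGrad_mul_add`). The factors `φ_l` are then constant too, and the equations
reduce to the Poincaré geodesic equations of the components, which do not involve `t`. For the
distance, `q ↦ √φ(q²)` is a norm on nonnegative vectors. Integrating its supporting functionals and
using the Poincaré distance in each disk bounds lengths from below; products of disk geodesics of
constant speed attain the bound. Completeness follows since the distance dominates the Poincaré
distance of each component. -/

namespace ComplexFinsler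

/-! ### The profile function: derivatives, convexity, homogeneity. -/

section

variable {n : ℕ}

/-- The metrics `F_{t,k}` are given by `F² = profile t k a`, where `a l` is the square of the
Poincaré norm of the `l`-th component. -/
noncomputable def profile (t : ℝ) (k : ℕ) (a : Fin n → ℝ) : ℝ :=
  (∑ l, a l + t * (∑ l, a l ^ k) ^ ((1 : ℝ) / k)) / (1 + t)

/-- The partial derivatives of `profile`. -/
noncomputable def profileGrad (t : ℝ) (k : ℕ) (a : Fin n → ℝ) (l : Fin n) : ℝ :=
  (1 + t * (∑ j, a j ^ k) ^ ((1 : ℝ) / k - 1) * a l ^ (k - 1)) / (1 + t)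

/-- The second partial derivatives of `profile`. -/
noncomputable def profileHess (t : ℝ) (k : ℕ) (a : Fin n → ℝ) (i j : Fin n) : ℝ :=
  t * (k - 1) * ((if i = j then (∑ l, a l ^ k) ^ ((1 : ℝ) / k - 1) * a j ^ (k - 2) else 0) -
    (∑ l, a l ^ k) ^ ((1 : ℝ) / k - 2) * a i ^ (k - 1) * a j ^ (k - 1)) / (1 + t)

lemma sum_pow_pos {a : Fin n → ℝ} (ha : ∀ l, 0 ≤ a l) (h0 : a ≠ 0) (k : ℕ) :
    0 < ∑ l, a l ^ k := by
  obtain ⟨l, hl⟩ := Function.ne_iff.1 h0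
  exact Finset.sum_pos' (fun i _ => pow_nonneg (ha i) k)
    ⟨l, Finset.mem_univ l, pow_pos (lt_of_le_of_ne (ha l) (Ne.symm hl)) k⟩

lemma hasFDerivAt_sum_pow (k : ℕ) (a : Fin n → ℝ) :
    HasFDerivAt (fun a : Fin n → ℝ => ∑ l, a l ^ k)
      (∑ l, ((k : ℝ) * a l ^ (k - 1)) • (ContinuousLinearMap.proj l : (Fin n → ℝ) →L[ℝ] ℝ)) a := by
  refine HasFDerivAt.fun_sum fun l _ => ?_
  have h : HasFDerivAt (fun a : Fin n → ℝ => a l)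
      (ContinuousLinearMap.proj l : (Fin n → ℝ) →L[ℝ] ℝ) a := hasFDerivAt_apply l a
  simpa using h.pow k

/-- The hypothesis `hS` keeps the base of the power `1 / k` away from `0`, where that power is not
differentiable. For `a = hypSq z v` it amounts to `v ≠ 0`. -/
lemma hasFDerivAt_profile (t : ℝ) {k : ℕ} (hk : 2 ≤ k) {a : Fin n → ℝ}
    (hS : 0 < ∑ l, a l ^ k) :
    HasFDerivAt (profile t k)
      (∑ l, profileGrad t k a l • (ContinuousLinearMap.proj l : (Fin n → ℝ) →L[ℝ] ℝ)) a := by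
  have h1 : HasFDerivAt (fun a : Fin n → ℝ => ∑ l, a l)
      (∑ l, (ContinuousLinearMap.proj l : (Fin n → ℝ) →L[ℝ] ℝ)) a :=
    HasFDerivAt.fun_sum fun l _ => hasFDerivAt_apply l a
  have h2 := (hasFDerivAt_sum_pow k a).rpow_const (p := (1 : ℝ) / k) (Or.inl hS.ne')
  have h3 := (h1.add (h2.const_mul t)).mul_const (1 + t)⁻¹
  refine (h3.congr_fderiv ?_).congr_of_eventuallyEq ?_
  · ext b
    have hk0 : (k : ℝ) ≠ 0 := by positivity
    simp only [smul_add, add_apply, smul_apply,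
      sum_apply, ContinuousLinearMap.proj_apply, smul_eq_mul, Finset.mul_sum,
      profileGrad, ← Finset.sum_add_distrib]
    refine Finset.sum_congr rfl fun l _ => ?_
    field_simp
  · exact Filter.Eventually.of_forall fun b => by simp [profile, div_eq_mul_inv]

lemma hasFDerivAt_profileGrad (t : ℝ) {k : ℕ} (hk : 2 ≤ k) {a : Fin n → ℝ}
    (hS : 0 < ∑ l, a l ^ k) (j : Fin n) :
    HasFDerivAt (fun a => profileGrad t k a j)
      (∑ i, profileHess t k a i j • (ContinuousLinearMap.proj i : (Fin n → ℝ) →L[ℝ] ℝ)) a := by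
  have h2 := (hasFDerivAt_sum_pow k a).rpow_const (p := (1 : ℝ) / k - 1) (Or.inl hS.ne')
  have hj : HasFDerivAt (fun a : Fin n → ℝ => a j)
      (ContinuousLinearMap.proj j : (Fin n → ℝ) →L[ℝ] ℝ) a := hasFDerivAt_apply j a
  have h4 := hj.pow (k - 1)
  have h3 := (((h2.const_mul t).mul h4).const_add 1).mul_const (1 + t)⁻¹
  refine (h3.congr_fderiv ?_).congr_of_eventuallyEq ?_
  · ext b
    have hk0 : (k : ℝ) ≠ 0 := by positivity
    have hcast : ((k - 1 : ℕ) : ℝ) = k - 1 := by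
      rw [Nat.cast_sub (by omega)]; simp
    have he : (1 : ℝ) / k - 1 - 1 = 1 / k - 2 := by ring
    have hke : k - 1 - 1 = k - 2 := by omega
    simp only [smul_add, add_apply, smul_apply,
      sum_apply, ContinuousLinearMap.proj_apply, smul_eq_mul,
      profileHess, hcast, he, hke, nsmul_eq_mul]
    -- The Hessian is a diagonal matrix minus a rank-one matrix; separating the two lets each sum
    -- collapse.
    have hsplit : ∀ i, t * (↑k - 1) * ((if i = j then (∑ l, a l ^ k) ^ ((1 : ℝ) / k - 1) *
          a j ^ (k - 2) else 0) -
          (∑ l, a l ^ k) ^ ((1 : ℝ) / k - 2) * a i ^ (k - 1) * a j ^ (k - 1)) / (1 + t) * b i =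
        (if i = j then t * (↑k - 1) * ((∑ l, a l ^ k) ^ ((1 : ℝ) / k - 1) *
          a j ^ (k - 2)) / (1 + t) * b i else 0) +
        (-(t * (↑k - 1) * (∑ l, a l ^ k) ^ ((1 : ℝ) / k - 2) * a j ^ (k - 1)) / (1 + t)) *
          (a i ^ (k - 1) * b i) := by
      intro i
      split_ifs <;> ring
    simp only [Finset.sum_congr rfl fun i _ => hsplit i]
    simp only [Finset.sum_add_distrib, Finset.sum_ite_eq', Finset.mem_univ, if_true,
      ← Finset.mul_sum, mul_assoc (k : ℝ)]
    generalize (∑ l, a l ^ k) ^ ((1 : ℝ) / k - 1) = p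
    generalize (∑ l, a l ^ k) ^ ((1 : ℝ) / k - 2) = q
    generalize ∑ i, a i ^ (k - 1) * b i = r
    field_simp
    ring
  · exact Filter.Eventually.of_forall fun b => by simp [profileGrad, div_eq_mul_inv]

lemma profileHess_comm (t : ℝ) (k : ℕ) (a : Fin n → ℝ) (i j : Fin n) :
    profileHess t k a i j = profileHess t k a j i := by
  unfold profileHess
  by_cases h : i = j
  · subst h; rfl
  · rw [if_neg h, if_neg (Ne.symm h)]; ring

/-- Convexity of the `ℓ^k` norm: by Cauchy-Schwarz, with `a^(k-1) b` viewed as the product of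
`a^(k/2)` and `a^(k/2-1) b`, the rank-one part of the Hessian is dominated by the diagonal part. -/
lemma profileHess_nonneg {t : ℝ} (ht : 0 ≤ t) {k : ℕ} (hk : 2 ≤ k) {a : Fin n → ℝ}
    (ha : ∀ l, 0 ≤ a l) (hS : 0 < ∑ l, a l ^ k) (b : Fin n → ℝ) :
    0 ≤ ∑ i, ∑ j, profileHess t k a i j * b i * b j := by
  set S := ∑ l, a l ^ k with hSdef
  have hexp : ∑ i, ∑ j, profileHess t k a i j * b i * b j =
      t * (k - 1) / (1 + t) * (S ^ ((1 : ℝ) / k - 1) * ∑ i, a i ^ (k - 2) * b i ^ 2 -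
        S ^ ((1 : ℝ) / k - 2) * (∑ i, a i ^ (k - 1) * b i) ^ 2) := by
    have hsplit : ∀ i j, profileHess t k a i j * b i * b j =
        (if i = j then t * (k - 1) / (1 + t) * (S ^ ((1 : ℝ) / k - 1) * (a j ^ (k - 2) * b j ^ 2))
          else 0) + (-(t * (k - 1) / (1 + t) * S ^ ((1 : ℝ) / k - 2))) *
          ((a i ^ (k - 1) * b i) * (a j ^ (k - 1) * b j)) := by
      intro i j
      unfold profileHess
      split_ifs with h
      · subst h; ring
      · ring
    simp only [hsplit, Finset.sum_add_distrib, Finset.sum_ite_eq, Finset.mem_univ, if_true,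
      ← Finset.mul_sum, sq, Finset.sum_mul_sum]
    ring
  have hcs : (∑ i, a i ^ (k - 1) * b i) ^ 2 ≤ S * ∑ i, a i ^ (k - 2) * b i ^ 2 := by
    refine Finset.sum_sq_le_sum_mul_sum_of_sq_le_mul _ (fun i _ => pow_nonneg (ha i) k)
      (fun i _ => mul_nonneg (pow_nonneg (ha i) _) (sq_nonneg _)) (fun i _ => le_of_eq ?_)
    obtain ⟨m, rfl⟩ := Nat.exists_eq_add_of_le' hk
    simp only [Nat.add_sub_cancel, show m + 2 - 1 = m + 1 by omega]
    ring
  have hpow : S ^ ((1 : ℝ) / k - 1) = S ^ ((1 : ℝ) / k - 2) * S := by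
    rw [← Real.rpow_add_one hS.ne']; congr 1; ring
  rw [hexp, hpow, mul_assoc, ← mul_sub]
  have hk1 : (0 : ℝ) ≤ k - 1 := by
    have : (2 : ℝ) ≤ k := by exact_mod_cast hk
    linarith
  have := sub_nonneg.2 hcs
  positivity

/-- The bound comes from the linear part of `profile`. It survives at `a l = 0`, where the
derivative of the `ℓ^k` norm vanishes, and this keeps the metric nondegenerate in those directions.
-/
lemma profileGrad_ge {t : ℝ} (ht : 0 ≤ t) (k : ℕ) {a : Fin n → ℝ} (ha : ∀ l, 0 ≤ a l)
    (l : Fin n) : 1 / (1 + t) ≤ profileGrad t k a l := by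
  unfold profileGrad
  have h1 : 0 ≤ ∑ j, a j ^ k := Finset.sum_nonneg fun i _ => pow_nonneg (ha i) k
  have h2 := pow_nonneg (ha l) (k - 1)
  gcongr
  have : 0 ≤ t * (∑ j, a j ^ k) ^ ((1 : ℝ) / k - 1) * a l ^ (k - 1) := by positivity
  linarith

lemma profileGrad_pos {t : ℝ} (ht : 0 ≤ t) (k : ℕ) {a : Fin n → ℝ} (ha : ∀ l, 0 ≤ a l)
    (l : Fin n) : 0 < profileGrad t k a l :=
  lt_of_lt_of_le (by positivity) (profileGrad_ge ht k ha l)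

/-- Euler's identity for a function homogeneous of degree one. -/
lemma sum_profileGrad_mul (t : ℝ) {k : ℕ} (hk : 2 ≤ k) {a : Fin n → ℝ}
    (hS : 0 < ∑ l, a l ^ k) : ∑ l, profileGrad t k a l * a l = profile t k a := by
  have hsplit : ∀ l, profileGrad t k a l * a l = a l / (1 + t) +
      t * (∑ j, a j ^ k) ^ ((1 : ℝ) / k - 1) / (1 + t) * a l ^ k := by
    intro l
    obtain ⟨m, rfl⟩ := Nat.exists_eq_add_of_le' hk
    simp only [profileGrad, show m + 2 - 1 = m + 1 by omega]
    ring
  simp only [hsplit, Finset.sum_add_distrib, ← Finset.mul_sum, ← Finset.sum_div, profile]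
  have : (∑ j, a j ^ k) ^ ((1 : ℝ) / k) =
      (∑ j, a j ^ k) ^ ((1 : ℝ) / k - 1) * ∑ j, a j ^ k := by
    rw [← Real.rpow_add_one hS.ne']; congr 1; ring
  rw [this]
  ring

lemma profile_nonneg {t : ℝ} (ht : 0 ≤ t) (k : ℕ) {a : Fin n → ℝ} (ha : ∀ l, 0 ≤ a l) :
    0 ≤ profile t k a := by
  have h1 : 0 ≤ ∑ j, a j := Finset.sum_nonneg fun i _ => ha i
  have h2 : 0 ≤ ∑ j, a j ^ k := Finset.sum_nonneg fun i _ => pow_nonneg (ha i) k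
  unfold profile
  positivity

/-- `profile` is the average, with weights `1` and `t`, of the `ℓ¹` and `ℓ^k` norms, each of which
dominates every coordinate. -/
lemma le_profile {t : ℝ} (ht : 0 ≤ t) {k : ℕ} (hk : 2 ≤ k) {a : Fin n → ℝ} (ha : ∀ l, 0 ≤ a l)
    (l : Fin n) : a l ≤ profile t k a := by
  have h1 : a l ≤ ∑ j, a j := Finset.single_le_sum (fun i _ => ha i) (Finset.mem_univ l)
  have h2 : a l ^ k ≤ ∑ j, a j ^ k :=
    Finset.single_le_sum (f := fun j => a j ^ k) (fun i _ => pow_nonneg (ha i) k)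
      (Finset.mem_univ l)
  have h3 : a l ≤ (∑ j, a j ^ k) ^ ((1 : ℝ) / k) := by
    calc a l = (a l ^ k) ^ ((1 : ℝ) / k) := by
          rw [one_div, Real.pow_rpow_inv_natCast (ha l) (by omega)]
      _ ≤ _ := Real.rpow_le_rpow (pow_nonneg (ha l) k) h2 (by positivity)
  unfold profile
  rw [le_div_iff₀ (by linarith)]
  nlinarith

lemma profile_pos {t : ℝ} (ht : 0 ≤ t) {k : ℕ} (hk : 2 ≤ k) {a : Fin n → ℝ} (ha : ∀ l, 0 ≤ a l)
    (h0 : a ≠ 0) : 0 < profile t k a := by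
  obtain ⟨l, hl⟩ := Function.ne_iff.1 h0
  exact (lt_of_le_of_ne (ha l) (Ne.symm hl)).trans_le (le_profile ht hk ha l)

lemma profile_smul {t c : ℝ} (hc : 0 ≤ c) {k : ℕ} (hk : 2 ≤ k) {a : Fin n → ℝ}
    (ha : ∀ l, 0 ≤ a l) : profile t k (fun l => c * a l) = c * profile t k a := by
  have h2 : 0 ≤ ∑ j, a j ^ k := Finset.sum_nonneg fun i _ => pow_nonneg (ha i) k
  simp only [profile, mul_pow, ← Finset.mul_sum]
  rw [Real.mul_rpow (by positivity) h2, one_div, Real.pow_rpow_inv_natCast hc (by omega)]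
  ring

end

section

variable {n : ℕ}

/-! ### Wirtinger derivatives -/

lemma dz_eq_of_hasFDerivAt {α : Fin n} {f : (Fin n → ℂ) → ℂ} {f' : (Fin n → ℂ) →L[ℝ] ℂ}
    {p : Fin n → ℂ} (h : HasFDerivAt f f' p) :
    dz α f p = (f' (Pi.single α 1) - Complex.I * f' (Pi.single α Complex.I)) / 2 := by
  rw [dz, h.fderiv]

lemma dzbar_eq_of_hasFDerivAt {α : Fin n} {f : (Fin n → ℂ) → ℂ} {f' : (Fin n → ℂ) →L[ℝ] ℂ}
    {p : Fin n → ℂ} (h : HasFDerivAt f f' p) :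
    dzbar α f p = (f' (Pi.single α 1) + Complex.I * f' (Pi.single α Complex.I)) / 2 := by
  rw [dzbar, h.fderiv]

lemma dz_congr {α : Fin n} {f g : (Fin n → ℂ) → ℂ} {p : Fin n → ℂ}
    (h : f =ᶠ[nhds p] g) : dz α f p = dz α g p := by
  rw [dz, dz, h.fderiv_eq]

lemma dzbar_congr {α : Fin n} {f g : (Fin n → ℂ) → ℂ} {p : Fin n → ℂ}
    (h : f =ᶠ[nhds p] g) : dzbar α f p = dzbar α g p := by
  rw [dzbar, dzbar, h.fderiv_eq]

lemma dz_mul {α : Fin n} {f g : (Fin n → ℂ) → ℂ} {p : Fin n → ℂ}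
    (hf : DifferentiableAt ℝ f p) (hg : DifferentiableAt ℝ g p) :
    dz α (fun w => f w * g w) p = dz α f p * g p + f p * dz α g p := by
  refine (dz_eq_of_hasFDerivAt (hf.hasFDerivAt.mul hg.hasFDerivAt)).trans ?_
  rw [dz, dz]
  simp only [add_apply, smul_apply, smul_eq_mul]
  ring

lemma dzbar_mul {α : Fin n} {f g : (Fin n → ℂ) → ℂ} {p : Fin n → ℂ}
    (hf : DifferentiableAt ℝ f p) (hg : DifferentiableAt ℝ g p) :
    dzbar α (fun w => f w * g w) p = dzbar α f p * g p + f p * dzbar α g p := by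
  refine (dzbar_eq_of_hasFDerivAt (hf.hasFDerivAt.mul hg.hasFDerivAt)).trans ?_
  rw [dzbar, dzbar]
  simp only [add_apply, smul_apply, smul_eq_mul]
  ring

lemma hasFDerivAt_coord (l : Fin n) (p : Fin n → ℂ) :
    HasFDerivAt (fun w : Fin n → ℂ => w l)
      (ContinuousLinearMap.proj l : (Fin n → ℂ) →L[ℝ] ℂ) p := hasFDerivAt_apply l p

lemma dz_coord (α l : Fin n) (p : Fin n → ℂ) :
    dz α (fun w => w l) p = if l = α then 1 else 0 := by
  rw [dz_eq_of_hasFDerivAt (hasFDerivAt_coord l p)]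
  by_cases h : l = α
  · subst h; simp
  · simp [h]

lemma dzbar_coord (α l : Fin n) (p : Fin n → ℂ) : dzbar α (fun w => w l) p = 0 := by
  rw [dzbar_eq_of_hasFDerivAt (hasFDerivAt_coord l p)]
  by_cases h : l = α
  · subst h; simp
  · simp [h]

lemma dz_const (α : Fin n) (c : ℂ) (p : Fin n → ℂ) : dz α (fun _ => c) p = 0 := by
  simp [dz]

lemma dzbar_const (α : Fin n) (c : ℂ) (p : Fin n → ℂ) : dzbar α (fun _ => c) p = 0 := by
  simp [dzbar]

lemma hasFDerivAt_ofReal {r : (Fin n → ℂ) → ℝ} {r' : (Fin n → ℂ) →L[ℝ] ℝ} {p : Fin n → ℂ}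
    (h : HasFDerivAt r r' p) :
    HasFDerivAt (fun w => (r w : ℂ)) (Complex.ofRealCLM.comp r') p :=
  Complex.ofRealCLM.hasFDerivAt.comp p h

lemma dz_ofReal {α : Fin n} {r : (Fin n → ℂ) → ℝ} {r' : (Fin n → ℂ) →L[ℝ] ℝ} {p : Fin n → ℂ}
    (h : HasFDerivAt r r' p) :
    dz α (fun w => (r w : ℂ)) p =
      ((r' (Pi.single α 1) : ℂ) - Complex.I * r' (Pi.single α Complex.I)) / 2 :=
  dz_eq_of_hasFDerivAt (hasFDerivAt_ofReal h)

lemma dzbar_ofReal {α : Fin n} {r : (Fin n → ℂ) → ℝ} {r' : (Fin n → ℂ) →L[ℝ] ℝ} {p : Fin n → ℂ}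
    (h : HasFDerivAt r r' p) :
    dzbar α (fun w => (r w : ℂ)) p =
      ((r' (Pi.single α 1) : ℂ) + Complex.I * r' (Pi.single α Complex.I)) / 2 :=
  dzbar_eq_of_hasFDerivAt (hasFDerivAt_ofReal h)

/-! ### The polydisk and the squared Poincaré norms of the components -/

lemma isOpen_polydisk : IsOpen (polydisk n) := by
  have : polydisk n = ⋂ l, {z | ‖z l‖ < 1} := by ext; simp [polydisk]
  rw [this]
  exact isOpen_iInter_of_finite fun l => isOpen_lt (by fun_prop) continuous_const

lemma one_sub_norm_sq_pos {z : Fin n → ℂ} (hz : z ∈ polydisk n) (l : Fin n) :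
    0 < 1 - ‖z l‖ ^ 2 := by
  have h := hz l
  have := norm_nonneg (z l)
  nlinarith

/-- The squares of the Poincaré norms of the components of a tangent vector of the polydisk. -/
noncomputable def hypSq (z v : Fin n → ℂ) (l : Fin n) : ℝ := ‖v l‖ ^ 2 / (1 - ‖z l‖ ^ 2) ^ 2

lemma hypSq_nonneg (z v : Fin n → ℂ) (l : Fin n) : 0 ≤ hypSq z v l := by
  unfold hypSq; positivity

lemma hypSq_ne_zero {z : Fin n → ℂ} (hz : z ∈ polydisk n) {v : Fin n → ℂ} (hv : v ≠ 0) :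
    hypSq z v ≠ 0 := by
  obtain ⟨l, hl⟩ := Function.ne_iff.1 hv
  refine Function.ne_iff.2 ⟨l, ?_⟩
  have := one_sub_norm_sq_pos hz l
  have : 0 < ‖v l‖ := norm_pos_iff.2 hl
  simp only [hypSq, Pi.zero_apply]
  positivity

lemma sum_hypSq_pow_pos {z : Fin n → ℂ} (hz : z ∈ polydisk n) {v : Fin n → ℂ} (hv : v ≠ 0)
    (k : ℕ) : 0 < ∑ l, hypSq z v l ^ k :=
  sum_pow_pos (hypSq_nonneg z v) (hypSq_ne_zero hz hv) k

lemma polydiskMetric_eq_sqrt {t : ℝ} (ht : 0 ≤ t) (k : ℕ) (z v : Fin n → ℂ) :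
    polydiskMetric n t k z v = √(profile t k (hypSq z v)) := by
  have : ∀ l, ‖v l‖ ^ (2 * k) / (1 - ‖z l‖ ^ 2) ^ (2 * k) = hypSq z v l ^ k := by
    intro l; rw [hypSq, div_pow, pow_mul, pow_mul]
  simp only [polydiskMetric, this]
  rw [profile, Real.sqrt_div' _ (by linarith), one_div_mul_eq_div]
  rfl

lemma energy_polydiskMetric {t : ℝ} (ht : 0 ≤ t) (k : ℕ) (z v : Fin n → ℂ) :
    energy (polydiskMetric n t k) z v = profile t k (hypSq z v) := by
  rw [energy, polydiskMetric_eq_sqrt ht, Real.sq_sqrt (profile_nonneg ht k (hypSq_nonneg z v))]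

/-- The differential of `hypSq` along the fibres. -/
noncomputable def hypSqFiberDeriv (z w : Fin n → ℂ) : (Fin n → ℂ) →L[ℝ] (Fin n → ℝ) :=
  ContinuousLinearMap.pi fun l => (2 / (1 - ‖z l‖ ^ 2) ^ 2) •
    (innerSL ℝ (w l)).comp (ContinuousLinearMap.proj l : (Fin n → ℂ) →L[ℝ] ℂ)

/-- The differential of `hypSq` along the base. -/
noncomputable def hypSqBaseDeriv (z w : Fin n → ℂ) : (Fin n → ℂ) →L[ℝ] (Fin n → ℝ) :=
  ContinuousLinearMap.pi fun l => (4 * ‖w l‖ ^ 2 / (1 - ‖z l‖ ^ 2) ^ 3) •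
    (innerSL ℝ (z l)).comp (ContinuousLinearMap.proj l : (Fin n → ℂ) →L[ℝ] ℂ)

lemma hypSqFiberDeriv_apply (z w u : Fin n → ℂ) (l : Fin n) :
    hypSqFiberDeriv z w u l = 2 / (1 - ‖z l‖ ^ 2) ^ 2 * inner ℝ (w l) (u l) := rfl

lemma hypSqBaseDeriv_apply (z w u : Fin n → ℂ) (l : Fin n) :
    hypSqBaseDeriv z w u l = 4 * ‖w l‖ ^ 2 / (1 - ‖z l‖ ^ 2) ^ 3 * inner ℝ (z l) (u l) := rfl

lemma hypSqFiberDeriv_single (z w : Fin n → ℂ) (α : Fin n) (c : ℂ) :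
    hypSqFiberDeriv z w (Pi.single α c) =
      Pi.single α (2 / (1 - ‖z α‖ ^ 2) ^ 2 * inner ℝ (w α) c) := by
  ext l
  rw [hypSqFiberDeriv_apply]
  by_cases h : l = α
  · subst h; simp
  · simp [h]

lemma hypSqBaseDeriv_single (z w : Fin n → ℂ) (α : Fin n) (c : ℂ) :
    hypSqBaseDeriv z w (Pi.single α c) =
      Pi.single α (4 * ‖w α‖ ^ 2 / (1 - ‖z α‖ ^ 2) ^ 3 * inner ℝ (z α) c) := by
  ext l
  rw [hypSqBaseDeriv_apply]
  by_cases h : l = α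
  · subst h; simp
  · simp [h]

lemma re_sub_im_mul_I (w : ℂ) : (w.re : ℂ) - w.im * Complex.I = conj w := by
  apply Complex.ext <;> simp

lemma inner_real_one (w : ℂ) : inner ℝ w 1 = w.re := by simp [Complex.inner]

lemma inner_real_I (w : ℂ) : inner ℝ w Complex.I = w.im := by simp [Complex.inner]

lemma hasFDerivAt_norm_sq_coord (l : Fin n) (w : Fin n → ℂ) :
    HasFDerivAt (fun w : Fin n → ℂ => ‖w l‖ ^ 2)
      ((2 : ℝ) • (innerSL ℝ (w l)).comp (ContinuousLinearMap.proj l : (Fin n → ℂ) →L[ℝ] ℂ)) w := by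
  have := (hasFDerivAt_coord l w).norm_sq
  rwa [← Nat.cast_smul_eq_nsmul ℝ] at this

lemma hasFDerivAt_hypSq_fiber (z w : Fin n → ℂ) :
    HasFDerivAt (hypSq z) (hypSqFiberDeriv z w) w := by
  refine hasFDerivAt_pi.2 fun l => ?_
  refine ((hasFDerivAt_norm_sq_coord l w).mul_const ((1 - ‖z l‖ ^ 2) ^ 2)⁻¹).congr_fderiv ?_
  rw [smul_smul]
  congr 1
  ring

lemma hasFDerivAt_hypSq_base {z : Fin n → ℂ} (hz : z ∈ polydisk n) (w : Fin n → ℂ) :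
    HasFDerivAt (fun y => hypSq y w) (hypSqBaseDeriv z w) z := by
  refine hasFDerivAt_pi.2 fun l => ?_
  have hpos := one_sub_norm_sq_pos hz l
  have h0 : HasDerivAt (fun x : ℝ => ‖w l‖ ^ 2 / (1 - x) ^ 2)
      (2 * ‖w l‖ ^ 2 / (1 - ‖z l‖ ^ 2) ^ 3) (‖z l‖ ^ 2) := by
    have h1 := (((hasDerivAt_id (‖z l‖ ^ 2)).const_sub 1).pow 2)
    refine ((hasDerivAt_const _ (‖w l‖ ^ 2)).div h1 (by simpa using hpos.ne')).congr_deriv ?_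
    simp only [id, Pi.pow_apply]
    field_simp
    ring
  refine (h0.comp_hasFDerivAt z (hasFDerivAt_norm_sq_coord l z)).congr_fderiv ?_
  rw [smul_smul]
  congr 1
  ring

/-! ### First derivatives of the energy -/

/-- The differential of `profile`. -/
noncomputable def profileDeriv (t : ℝ) (k : ℕ) (a : Fin n → ℝ) : (Fin n → ℝ) →L[ℝ] ℝ :=
  ∑ l, profileGrad t k a l • (ContinuousLinearMap.proj l : (Fin n → ℝ) →L[ℝ] ℝ)

/-- The differential of the partial derivatives of `profile`. -/
noncomputable def profileGradDeriv (t : ℝ) (k : ℕ) (a : Fin n → ℝ) (j : Fin n) :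
    (Fin n → ℝ) →L[ℝ] ℝ :=
  ∑ i, profileHess t k a i j • (ContinuousLinearMap.proj i : (Fin n → ℝ) →L[ℝ] ℝ)

lemma profileDeriv_apply (t : ℝ) (k : ℕ) (a b : Fin n → ℝ) :
    profileDeriv t k a b = ∑ l, profileGrad t k a l * b l := by
  simp [profileDeriv]

lemma profileGradDeriv_apply (t : ℝ) (k : ℕ) (a b : Fin n → ℝ) (j : Fin n) :
    profileGradDeriv t k a j b = ∑ i, profileHess t k a i j * b i := by
  simp [profileGradDeriv]

lemma profileDeriv_single (t : ℝ) (k : ℕ) (a : Fin n → ℝ) (i : Fin n) (c : ℝ) :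
    profileDeriv t k a (Pi.single i c) = profileGrad t k a i * c := by
  simp [profileDeriv_apply, Pi.single_apply]

lemma profileGradDeriv_single (t : ℝ) (k : ℕ) (a : Fin n → ℝ) (i j : Fin n) (c : ℝ) :
    profileGradDeriv t k a j (Pi.single i c) = profileHess t k a i j * c := by
  simp [profileGradDeriv_apply, Pi.single_apply]

variable {t : ℝ} {k : ℕ} {z w : Fin n → ℂ}

lemma hasFDerivAt_energy_fiber (ht : 0 ≤ t) (hk : 2 ≤ k) (hz : z ∈ polydisk n) (hw : w ≠ 0) :
    HasFDerivAt (energy (polydiskMetric n t k) z)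
      ((profileDeriv t k (hypSq z w)).comp (hypSqFiberDeriv z w)) w := by
  have : energy (polydiskMetric n t k) z = profile t k ∘ hypSq z := by
    funext v; exact energy_polydiskMetric ht k z v
  rw [this]
  exact (hasFDerivAt_profile t hk (sum_hypSq_pow_pos hz hw k)).comp w (hasFDerivAt_hypSq_fiber z w)

lemma hasFDerivAt_energy_base (ht : 0 ≤ t) (hk : 2 ≤ k) (hz : z ∈ polydisk n) (hw : w ≠ 0) :
    HasFDerivAt (fun y => energy (polydiskMetric n t k) y w)
      ((profileDeriv t k (hypSq z w)).comp (hypSqBaseDeriv z w)) z := by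
  have : (fun y => energy (polydiskMetric n t k) y w) = profile t k ∘ fun y => hypSq y w := by
    funext v; exact energy_polydiskMetric ht k v w
  rw [this]
  exact HasFDerivAt.comp z (hasFDerivAt_profile t hk (sum_hypSq_pow_pos hz hw k))
    (hasFDerivAt_hypSq_base hz w)

lemma hasFDerivAt_profileGrad_fiber (hk : 2 ≤ k) (hz : z ∈ polydisk n) (hw : w ≠ 0) (j : Fin n) :
    HasFDerivAt (fun w => profileGrad t k (hypSq z w) j)
      ((profileGradDeriv t k (hypSq z w) j).comp (hypSqFiberDeriv z w)) w :=
  HasFDerivAt.comp w (hasFDerivAt_profileGrad t hk (sum_hypSq_pow_pos hz hw k) j)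
    (hasFDerivAt_hypSq_fiber z w)

lemma dz_energyC (ht : 0 ≤ t) (hk : 2 ≤ k) (hz : z ∈ polydisk n) (hw : w ≠ 0) (α : Fin n) :
    dz α (energyC (polydiskMetric n t k) z) w =
      profileGrad t k (hypSq z w) α * (conj (w α) / (1 - ‖z α‖ ^ 2) ^ 2) := by
  refine (dz_ofReal (hasFDerivAt_energy_fiber ht hk hz hw)).trans ?_
  simp only [ContinuousLinearMap.comp_apply, hypSqFiberDeriv_single, profileDeriv_single,
    inner_real_one, inner_real_I]
  push_cast
  rw [← re_sub_im_mul_I]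
  ring

lemma dzbar_energyC (ht : 0 ≤ t) (hk : 2 ≤ k) (hz : z ∈ polydisk n) (hw : w ≠ 0) (α : Fin n) :
    dzbar α (energyC (polydiskMetric n t k) z) w =
      profileGrad t k (hypSq z w) α * (w α / (1 - ‖z α‖ ^ 2) ^ 2) := by
  refine (dzbar_ofReal (hasFDerivAt_energy_fiber ht hk hz hw)).trans ?_
  simp only [ContinuousLinearMap.comp_apply, hypSqFiberDeriv_single, profileDeriv_single,
    inner_real_one, inner_real_I]
  push_cast
  conv_rhs => rw [← Complex.re_add_im (w α)]
  ring

/-- The energy depends on both `z^α` and `v^α` only through `hypSq z v α`, so the base derivative is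
a multiple of the fibre derivative with a factor free of `t` and `k`. This is why the connection
does not see the profile. -/
lemma dz_energyC_base (ht : 0 ≤ t) (hk : 2 ≤ k) (hz : z ∈ polydisk n) (hw : w ≠ 0) (α : Fin n) :
    dz α (fun y => energyC (polydiskMetric n t k) y w) z =
      2 * conj (z α) / (1 - ‖z α‖ ^ 2) *
        (w α * dz α (energyC (polydiskMetric n t k) z) w) := by
  rw [dz_energyC ht hk hz hw]
  refine (dz_ofReal (hasFDerivAt_energy_base ht hk hz hw)).trans ?_
  simp only [ContinuousLinearMap.comp_apply, hypSqBaseDeriv_single, profileDeriv_single,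
    inner_real_one, inner_real_I]
  have hw2 : ((‖w α‖ : ℝ) : ℂ) ^ 2 = w α * conj (w α) := (Complex.mul_conj' _).symm
  have hpos : (1 - (‖z α‖ : ℂ) ^ 2) ≠ 0 := by
    exact_mod_cast (one_sub_norm_sq_pos hz α).ne'
  push_cast
  rw [hw2, ← re_sub_im_mul_I (z α)]
  field_simp
  ring

/-! ### Second derivatives -/

lemma dz_profileGrad (hk : 2 ≤ k) (hz : z ∈ polydisk n) (hw : w ≠ 0) (α β : Fin n) :
    dz α (fun w => (profileGrad t k (hypSq z w) β : ℂ)) w =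
      profileHess t k (hypSq z w) α β * (conj (w α) / (1 - ‖z α‖ ^ 2) ^ 2) := by
  refine (dz_ofReal (hasFDerivAt_profileGrad_fiber hk hz hw β)).trans ?_
  simp only [ContinuousLinearMap.comp_apply, hypSqFiberDeriv_single, profileGradDeriv_single,
    inner_real_one, inner_real_I]
  push_cast
  rw [← re_sub_im_mul_I]
  ring

lemma dzbar_profileGrad (hk : 2 ≤ k) (hz : z ∈ polydisk n) (hw : w ≠ 0) (α β : Fin n) :
    dzbar α (fun w => (profileGrad t k (hypSq z w) β : ℂ)) w =
      profileHess t k (hypSq z w) α β * (w α / (1 - ‖z α‖ ^ 2) ^ 2) := by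
  refine (dzbar_ofReal (hasFDerivAt_profileGrad_fiber hk hz hw β)).trans ?_
  simp only [ContinuousLinearMap.comp_apply, hypSqFiberDeriv_single, profileGradDeriv_single,
    inner_real_one, inner_real_I]
  push_cast
  conv_rhs => rw [← Complex.re_add_im (w α)]
  ring

lemma hasFDerivAt_conj_coord (l : Fin n) (p : Fin n → ℂ) :
    HasFDerivAt (fun w : Fin n → ℂ => conj (w l))
      ((Complex.conjCLE : ℂ →L[ℝ] ℂ).comp
        (ContinuousLinearMap.proj l : (Fin n → ℂ) →L[ℝ] ℂ)) p :=
  (Complex.conjCLE : ℂ →L[ℝ] ℂ).hasFDerivAt.comp p (hasFDerivAt_coord l p)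

lemma dzbar_conj_coord (α l : Fin n) (p : Fin n → ℂ) :
    dzbar α (fun w => conj (w l)) p = if l = α then 1 else 0 := by
  rw [dzbar_eq_of_hasFDerivAt (hasFDerivAt_conj_coord l p)]
  by_cases h : l = α
  · subst h; simp
  · simp [h]

lemma eventually_ne_zero (hw : w ≠ 0) : ∀ᶠ v in nhds w, v ≠ 0 := isOpen_ne.mem_nhds hw

/-- Chain rule: the Hessian of the profile paired with the first derivatives of `hypSq`, plus its
gradient times the mixed second derivatives of `hypSq`, which are diagonal. -/
lemma leviMatrix_apply (ht : 0 ≤ t) (hk : 2 ≤ k) (hz : z ∈ polydisk n) (hw : w ≠ 0)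
    (α β : Fin n) :
    leviMatrix (polydiskMetric n t k) z w α β =
      profileHess t k (hypSq z w) α β *
          (conj (w α) / (1 - ‖z α‖ ^ 2) ^ 2) * (w β / (1 - ‖z β‖ ^ 2) ^ 2) +
        if β = α then (profileGrad t k (hypSq z w) β / (1 - ‖z β‖ ^ 2) ^ 2 : ℂ) else 0 := by
  have h1 : (fun v => dzbar β (energyC (polydiskMetric n t k) z) v) =ᶠ[nhds w]
      fun v => (profileGrad t k (hypSq z v) β : ℂ) * (v β * ((1 - ‖z β‖ ^ 2) ^ 2 : ℂ)⁻¹) := by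
    filter_upwards [eventually_ne_zero hw] with v hv
    rw [dzbar_energyC ht hk hz hv, div_eq_mul_inv]
  have hd := (hasFDerivAt_coord β w).differentiableAt
  rw [leviMatrix, Matrix.of_apply, dz_congr h1,
    dz_mul (hasFDerivAt_ofReal (hasFDerivAt_profileGrad_fiber hk hz hw β)).differentiableAt
      (hd.mul_const _), dz_mul hd (differentiableAt_const _), dz_coord, dz_const,
    dz_profileGrad hk hz hw]
  split_ifs <;> ring

/-- The connection coefficients take the two derivatives in the order opposite to the Levi matrix;
the explicit formulas show that they commute. -/
lemma dzbar_dz_energyC (ht : 0 ≤ t) (hk : 2 ≤ k) (hz : z ∈ polydisk n) (hw : w ≠ 0)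
    (α β : Fin n) :
    dzbar β (fun v => dz α (energyC (polydiskMetric n t k) z) v) w =
      leviMatrix (polydiskMetric n t k) z w α β := by
  have h1 : (fun v => dz α (energyC (polydiskMetric n t k) z) v) =ᶠ[nhds w]
      fun v => (profileGrad t k (hypSq z v) α : ℂ) * (conj (v α) * ((1 - ‖z α‖ ^ 2) ^ 2 : ℂ)⁻¹) := by
    filter_upwards [eventually_ne_zero hw] with v hv
    rw [dz_energyC ht hk hz hv, div_eq_mul_inv]
  have hd := (hasFDerivAt_conj_coord α w).differentiableAt
  rw [leviMatrix_apply ht hk hz hw, dzbar_congr h1,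
    dzbar_mul (hasFDerivAt_ofReal (hasFDerivAt_profileGrad_fiber hk hz hw α)).differentiableAt
      (hd.mul_const _), dzbar_mul hd (differentiableAt_const _), dzbar_conj_coord, dzbar_const,
    dzbar_profileGrad hk hz hw, profileHess_comm t k _ α β]
  by_cases h : α = β
  · subst h; simp only [if_true]; ring
  · rw [if_neg h, if_neg (Ne.symm h)]; ring

end

section

variable {n : ℕ} {t : ℝ} {k : ℕ} {z w : Fin n → ℂ}

/-! ### Strong pseudoconvexity and strong convexity -/

/-- The Hermitian form of a real symmetric matrix splits into its real forms on the real and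
imaginary parts, the cross terms cancelling by symmetry. -/
lemma profileHess_conj_nonneg (ht : 0 ≤ t) (hk : 2 ≤ k) {a : Fin n → ℝ}
    (ha : ∀ l, 0 ≤ a l) (hS : 0 < ∑ l, a l ^ k) (y : Fin n → ℂ) :
    0 ≤ ∑ i, ∑ j, (profileHess t k a i j : ℂ) * conj (y i) * y j := by
  have h : ∑ i, ∑ j, (profileHess t k a i j : ℂ) * conj (y i) * y j =
      ((∑ i, ∑ j, profileHess t k a i j * (y i).re * (y j).re +
        ∑ i, ∑ j, profileHess t k a i j * (y i).im * (y j).im : ℝ) : ℂ) := by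
    have hsum : ∑ i, ∑ j, (profileHess t k a i j : ℂ) * ((y i).re * (y j).im) =
        ∑ i, ∑ j, (profileHess t k a i j : ℂ) * ((y j).re * (y i).im) := by
      rw [Finset.sum_comm]
      exact Finset.sum_congr rfl fun i _ => Finset.sum_congr rfl fun j _ => by
        rw [profileHess_comm]
    have hsplit : ∀ i j, (profileHess t k a i j : ℂ) * conj (y i) * y j =
        (profileHess t k a i j : ℂ) * (y i).re * (y j).re +
        (profileHess t k a i j : ℂ) * (y i).im * (y j).im +
        ((profileHess t k a i j : ℂ) * ((y i).re * (y j).im) -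
          (profileHess t k a i j : ℂ) * ((y j).re * (y i).im)) * Complex.I := by
      intro i j
      conv_lhs => rw [← re_sub_im_mul_I (y i), ← Complex.re_add_im (y j)]
      linear_combination -(profileHess t k a i j : ℂ) * (y i).im * (y j).im * Complex.I_sq
    simp only [hsplit, Finset.sum_add_distrib, ← Finset.sum_mul, Finset.sum_sub_distrib, hsum]
    push_cast
    ring
  rw [h]
  exact_mod_cast add_nonneg (profileHess_nonneg ht hk ha hS _) (profileHess_nonneg ht hk ha hS _)

lemma posDef_leviMatrix (ht : 0 ≤ t) (hk : 2 ≤ k) (hz : z ∈ polydisk n) (hw : w ≠ 0) :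
    (leviMatrix (polydiskMetric n t k) z w).PosDef := by
  refine Matrix.PosDef.of_dotProduct_mulVec_pos ?_ fun x hx => ?_
  · ext α β
    rw [Matrix.conjTranspose_apply, leviMatrix_apply ht hk hz hw, leviMatrix_apply ht hk hz hw,
      profileHess_comm t k _ α β]
    by_cases h : α = β
    · subst h
      simp
      ring
    · simp [h, Ne.symm h]
      ring
  · have hexp : dotProduct (star x) (Matrix.mulVec (leviMatrix (polydiskMetric n t k) z w) x) =
        ∑ i, ∑ j, (profileHess t k (hypSq z w) i j : ℂ) *
          conj (w i * x i / (1 - ‖z i‖ ^ 2) ^ 2) * (w j * x j / (1 - ‖z j‖ ^ 2) ^ 2) +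
        ((∑ i, profileGrad t k (hypSq z w) i / (1 - ‖z i‖ ^ 2) ^ 2 * ‖x i‖ ^ 2 : ℝ) : ℂ) := by
      simp only [dotProduct, Matrix.mulVec, leviMatrix_apply ht hk hz hw, Finset.mul_sum, add_mul,
        mul_add, Finset.sum_add_distrib]
      congr 1
      · refine Finset.sum_congr rfl fun i _ => Finset.sum_congr rfl fun j _ => ?_
        simp
        ring
      · push_cast
        refine Finset.sum_congr rfl fun i _ => ?_
        simp only [ite_mul, zero_mul, mul_ite, mul_zero, Finset.sum_ite_eq', Finset.mem_univ,
          if_true, Pi.star_apply, RCLike.star_def]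
        rw [← Complex.conj_mul' (x i)]
        ring
    rw [hexp]
    refine add_pos_of_nonneg_of_pos
      (profileHess_conj_nonneg ht hk (hypSq_nonneg z w) (sum_hypSq_pow_pos hz hw k) _) ?_
    norm_cast
    obtain ⟨l, hl⟩ := Function.ne_iff.1 hx
    have hg : ∀ i, 0 < profileGrad t k (hypSq z w) i / (1 - ‖z i‖ ^ 2) ^ 2 := fun i =>
      div_pos (profileGrad_pos ht k (hypSq_nonneg z w) i) (pow_pos (one_sub_norm_sq_pos hz i) 2)
    refine Finset.sum_pos' (fun i _ => mul_nonneg (hg i).le (by positivity)) ⟨l, Finset.mem_univ l, ?_⟩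
    exact mul_pos (hg l) (pow_pos (norm_pos_iff.2 hl) 2)

lemma contDiffOn_energy (ht : 0 ≤ t) (k : ℕ) :
    ContDiffOn ℝ ∞ (fun p : (Fin n → ℂ) × (Fin n → ℂ) =>
      energy (polydiskMetric n t k) p.1 p.2) (polydisk n ×ˢ {0}ᶜ) := by
  simp only [energy_polydiskMetric ht, profile]
  have hh : ∀ l, ContDiffOn ℝ ∞ (fun p : (Fin n → ℂ) × (Fin n → ℂ) => hypSq p.1 p.2 l)
      (polydisk n ×ˢ {0}ᶜ) := by
    intro l
    have h1 : ContDiff ℝ ∞ fun p : (Fin n → ℂ) × (Fin n → ℂ) => ‖p.2 l‖ ^ 2 :=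
      ContDiff.norm_sq ℝ (by fun_prop)
    have h2 : ContDiff ℝ ∞ fun p : (Fin n → ℂ) × (Fin n → ℂ) => ‖p.1 l‖ ^ 2 :=
      ContDiff.norm_sq ℝ (by fun_prop)
    exact h1.contDiffOn.div ((contDiff_const.sub h2).pow 2).contDiffOn fun p hp =>
      (pow_pos (one_sub_norm_sq_pos hp.1 l) 2).ne'
  refine ContDiffOn.div_const (ContDiffOn.add (ContDiffOn.sum fun l _ => hh l)
    (contDiffOn_const.mul (ContDiffOn.rpow_const_of_ne (ContDiffOn.sum fun l _ => (hh l).pow k)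
      fun p hp => (sum_hypSq_pow_pos hp.1 hp.2 k).ne'))) _

lemma continuousOn_hypSq (l : Fin n) :
    ContinuousOn (fun p : (Fin n → ℂ) × (Fin n → ℂ) => hypSq p.1 p.2 l)
      (polydisk n ×ˢ Set.univ) := by
  refine ContinuousOn.div (by fun_prop) (by fun_prop) fun p hp =>
      (pow_pos (one_sub_norm_sq_pos hp.1 l) 2).ne'

lemma continuous_profile (t : ℝ) (k : ℕ) : Continuous (profile (n := n) t k) := by
  refine Continuous.div_const (Continuous.add (by fun_prop) (continuous_const.mul
    (Continuous.rpow_const (by fun_prop) fun _ => Or.inr (by positivity)))) _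

lemma continuousOn_polydiskMetric (ht : 0 ≤ t) (k : ℕ) :
    ContinuousOn (fun p : (Fin n → ℂ) × (Fin n → ℂ) => polydiskMetric n t k p.1 p.2)
      (polydisk n ×ˢ Set.univ) := by
  simp only [polydiskMetric_eq_sqrt ht]
  exact ((continuous_profile t k).comp_continuousOn
    (continuousOn_pi.2 fun l => continuousOn_hypSq l)).sqrt

lemma hypSq_smul (c : ℂ) (z v : Fin n → ℂ) :
    hypSq z (c • v) = fun l => ‖c‖ ^ 2 * hypSq z v l := by
  funext l
  simp only [hypSq, Pi.smul_apply, smul_eq_mul, norm_mul]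
  ring

theorem isStronglyPseudoconvex_polydiskMetric (ht : 0 ≤ t) (hk : 2 ≤ k) :
    IsStronglyPseudoconvex (polydisk n) (polydiskMetric n t k) where
  continuousOn := continuousOn_polydiskMetric ht k
  nonneg z _ v := by
    rw [polydiskMetric_eq_sqrt ht]
    exact Real.sqrt_nonneg _
  eq_zero_iff z hz v := by
    rw [polydiskMetric_eq_sqrt ht]
    constructor
    · intro h
      by_contra hv
      exact (Real.sqrt_pos.2 (profile_pos ht hk (hypSq_nonneg z v) (hypSq_ne_zero hz hv))).ne' h
    · rintro rfl
      have : hypSq z 0 = fun l => 0 * hypSq z 0 l := by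
        funext l; simp [hypSq]
      rw [this, profile_smul le_rfl hk (hypSq_nonneg z 0), zero_mul, Real.sqrt_zero]
  smooth := contDiffOn_energy ht k
  homogeneous z _ c v := by
    rw [energy_polydiskMetric ht, energy_polydiskMetric ht, hypSq_smul,
      profile_smul (by positivity) hk (hypSq_nonneg z v)]
  posDef z hz v hv := posDef_leviMatrix ht hk hz hv

/-- Half the second derivative of the energy along the fibres, as a bilinear form. -/
noncomputable def energyHess (t : ℝ) (k : ℕ) (z w : Fin n → ℂ) :
    (Fin n → ℂ) →ₗ[ℝ] (Fin n → ℂ) →ₗ[ℝ] ℝ :=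
  LinearMap.mk₂ ℝ (fun u e =>
    (∑ i, ∑ j, profileHess t k (hypSq z w) i j * hypSqFiberDeriv z w u i *
      hypSqFiberDeriv z w e j) / 2 +
    ∑ l, profileGrad t k (hypSq z w) l / (1 - ‖z l‖ ^ 2) ^ 2 * inner ℝ (u l) (e l))
    (fun u u' e => by
      simp only [map_add, Pi.add_apply, inner_add_left, mul_add, add_mul, Finset.sum_add_distrib]
      ring)
    (fun c u e => by
      simp only [map_smul, Pi.smul_apply, inner_smul_left, smul_eq_mul, mul_add, Finset.mul_sum,
        Finset.sum_div]
      congr 1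
      · exact Finset.sum_congr rfl fun i _ => Finset.sum_congr rfl fun j _ => by ring
      · exact Finset.sum_congr rfl fun i _ => by simp; ring)
    (fun u e e' => by
      simp only [map_add, Pi.add_apply, inner_add_right, mul_add, Finset.sum_add_distrib]
      ring)
    (fun c u e => by
      simp only [map_smul, Pi.smul_apply, inner_smul_right, smul_eq_mul, mul_add, Finset.mul_sum,
        Finset.sum_div]
      congr 1
      · exact Finset.sum_congr rfl fun i _ => Finset.sum_congr rfl fun j _ => by ring
      · exact Finset.sum_congr rfl fun i _ => by ring)

lemma energyHess_apply (u e : Fin n → ℂ) : energyHess t k z w u e =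
    (∑ i, ∑ j, profileHess t k (hypSq z w) i j * hypSqFiberDeriv z w u i *
      hypSqFiberDeriv z w e j) / 2 +
    ∑ l, profileGrad t k (hypSq z w) l / (1 - ‖z l‖ ^ 2) ^ 2 * inner ℝ (u l) (e l) := rfl

lemma energyHess_comm (u e : Fin n → ℂ) :
    energyHess t k z w u e = energyHess t k z w e u := by
  rw [energyHess_apply, energyHess_apply, Finset.sum_comm]
  congr 2
  · refine Finset.sum_congr rfl fun i _ => Finset.sum_congr rfl fun j _ => ?_
    rw [profileHess_comm]; ring
  · exact funext fun l => by rw [real_inner_comm]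

lemma energyHess_self_pos (ht : 0 ≤ t) (hk : 2 ≤ k) (hz : z ∈ polydisk n) (hw : w ≠ 0)
    {u : Fin n → ℂ} (hu : u ≠ 0) : 0 < energyHess t k z w u u := by
  rw [energyHess_apply]
  have h1 := profileHess_nonneg ht hk (hypSq_nonneg z w) (sum_hypSq_pow_pos hz hw k)
    (hypSqFiberDeriv z w u)
  refine add_pos_of_nonneg_of_pos (by positivity) ?_
  obtain ⟨l, hl⟩ := Function.ne_iff.1 hu
  have hg : ∀ i, 0 < profileGrad t k (hypSq z w) i / (1 - ‖z i‖ ^ 2) ^ 2 := fun i =>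
    div_pos (profileGrad_pos ht k (hypSq_nonneg z w) i) (pow_pos (one_sub_norm_sq_pos hz i) 2)
  refine Finset.sum_pos' (fun i _ => mul_nonneg (hg i).le real_inner_self_nonneg)
    ⟨l, Finset.mem_univ l, mul_pos (hg l) (real_inner_self_pos.2 hl)⟩

lemma fderiv_energy_fiber_apply (ht : 0 ≤ t) (hk : 2 ≤ k) (hz : z ∈ polydisk n) (hw : w ≠ 0)
    (e : Fin n → ℂ) : fderiv ℝ (energy (polydiskMetric n t k) z) w e =
      ∑ l, profileGrad t k (hypSq z w) l * (2 / (1 - ‖z l‖ ^ 2) ^ 2 * inner ℝ (w l) (e l)) := by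
  rw [(hasFDerivAt_energy_fiber ht hk hz hw).fderiv, ContinuousLinearMap.comp_apply,
    profileDeriv_apply]
  rfl

lemma fderiv_fderiv_energy (ht : 0 ≤ t) (hk : 2 ≤ k) (hz : z ∈ polydisk n) (hw : w ≠ 0)
    (u e : Fin n → ℂ) :
    fderiv ℝ (fun v => fderiv ℝ (energy (polydiskMetric n t k) z) v e) w u =
      2 * energyHess t k z w u e := by
  have h1 : (fun v => fderiv ℝ (energy (polydiskMetric n t k) z) v e) =ᶠ[nhds w] fun v =>
      ∑ l, profileGrad t k (hypSq z v) l * (2 / (1 - ‖z l‖ ^ 2) ^ 2 * inner ℝ (v l) (e l)) := by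
    filter_upwards [eventually_ne_zero hw] with v hv
    exact fderiv_energy_fiber_apply ht hk hz hv e
  have h2 : ∀ l, HasFDerivAt (fun v : Fin n → ℂ => inner ℝ (v l) (e l))
      ((innerSL ℝ (e l)).comp (ContinuousLinearMap.proj l : (Fin n → ℂ) →L[ℝ] ℂ)) w := by
    intro l
    have := (innerSL ℝ (e l)).hasFDerivAt.comp w (hasFDerivAt_coord l w)
    refine this.congr_of_eventuallyEq (Filter.Eventually.of_forall fun v => ?_)
    exact real_inner_comm _ _
  have h3 : HasFDerivAt (fun v => ∑ l, profileGrad t k (hypSq z v) l *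
      (2 / (1 - ‖z l‖ ^ 2) ^ 2 * inner ℝ (v l) (e l))) _ w := HasFDerivAt.fun_sum fun l _ =>
    (hasFDerivAt_profileGrad_fiber hk hz hw l).mul ((h2 l).const_mul _)
  rw [h1.fderiv_eq, h3.fderiv, energyHess_apply,
    Finset.sum_comm, mul_add, mul_div_cancel₀ _ two_ne_zero, Finset.mul_sum,
    ← Finset.sum_add_distrib, sum_apply]
  refine Finset.sum_congr rfl fun l _ => ?_
  simp only [add_apply, smul_apply, smul_eq_mul, ContinuousLinearMap.comp_apply,
    profileGradDeriv_apply, ContinuousLinearMap.proj_apply, innerSL_apply_apply, ← Finset.sum_mul,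
    hypSqFiberDeriv_apply _ _ e, real_inner_comm (u l) (e l)]
  ring

lemma sum_smul_realBasisVec (x : Fin n ⊕ Fin n → ℝ) (l : Fin n) :
    (∑ a, x a • realBasisVec a) l = x (Sum.inl l) + x (Sum.inr l) * Complex.I := by
  simp [realBasisVec, Pi.single_apply, Finset.sum_apply]

lemma posDef_fundamentalMatrix (ht : 0 ≤ t) (hk : 2 ≤ k) (hz : z ∈ polydisk n) (hw : w ≠ 0) :
    (fundamentalMatrix (polydiskMetric n t k) z w).PosDef := by
  have hM : ∀ a b, fundamentalMatrix (polydiskMetric n t k) z w a b =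
      energyHess t k z w (realBasisVec a) (realBasisVec b) := by
    intro a b
    rw [fundamentalMatrix, Matrix.of_apply, fderiv_fderiv_energy ht hk hz hw]
    ring
  refine Matrix.PosDef.of_dotProduct_mulVec_pos ?_ fun x hx => ?_
  · ext a b
    rw [Matrix.conjTranspose_apply, hM, hM, energyHess_comm]
    rfl
  -- A real coefficient vector is read as a tangent vector, so that the bilinear form `energyHess`
  -- applies.
  · have hxi : (∑ a, x a • realBasisVec a : Fin n → ℂ) ≠ 0 := by
      intro h
      apply hx
      have hl : ∀ l, (x (Sum.inl l) : ℂ) + x (Sum.inr l) * Complex.I = 0 := fun l => by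
        rw [← sum_smul_realBasisVec, h]; rfl
      funext a
      rcases a with l | l
      · simpa using congrArg Complex.re (hl l)
      · simpa using congrArg Complex.im (hl l)
    have := energyHess_self_pos ht hk hz hw hxi
    refine this.trans_eq ?_
    simp only [map_sum, LinearMap.sum_apply, map_smul, LinearMap.smul_apply, smul_eq_mul,
      dotProduct, Matrix.mulVec, hM, Finset.mul_sum, star_trivial]
    rw [Finset.sum_comm]
    exact Finset.sum_congr rfl fun a _ => Finset.sum_congr rfl fun b _ => by ring

theorem isStronglyConvex_polydiskMetric (ht : 0 ≤ t) (hk : 2 ≤ k) :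
    IsStronglyConvex (polydisk n) (polydiskMetric n t k) :=
  ⟨isStronglyPseudoconvex_polydiskMetric ht hk,
    fun _ hz _ hv => posDef_fundamentalMatrix ht hk hz hv⟩

end

section

variable {n : ℕ} {t : ℝ} {k : ℕ} {z w : Fin n → ℂ}

/-! ### The Chern-Finsler connection -/

lemma dzbar_dz_energyC_base (ht : 0 ≤ t) (hk : 2 ≤ k) (hz : z ∈ polydisk n) (hw : w ≠ 0)
    (τ μ : Fin n) :
    dzbar τ (fun v => dz μ (fun y => energyC (polydiskMetric n t k) y v) z) w =
      2 * conj (z μ) / (1 - ‖z μ‖ ^ 2) * (w μ * leviMatrix (polydiskMetric n t k) z w μ τ) := by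
  have h1 : (fun v => dz μ (fun y => energyC (polydiskMetric n t k) y v) z) =ᶠ[nhds w]
      fun v => 2 * conj (z μ) / (1 - ‖z μ‖ ^ 2) *
        (v μ * dz μ (energyC (polydiskMetric n t k) z) v) := by
    filter_upwards [eventually_ne_zero hw] with v hv
    exact dz_energyC_base ht hk hz hv μ
  have h2 : (fun v => dz μ (energyC (polydiskMetric n t k) z) v) =ᶠ[nhds w]
      fun v => (profileGrad t k (hypSq z v) μ : ℂ) * (conj (v μ) * ((1 - ‖z μ‖ ^ 2) ^ 2 : ℂ)⁻¹) := by
    filter_upwards [eventually_ne_zero hw] with v hv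
    rw [dz_energyC ht hk hz hv, div_eq_mul_inv]
  have hd : DifferentiableAt ℝ (fun v => dz μ (energyC (polydiskMetric n t k) z) v) w :=
    ((hasFDerivAt_ofReal (hasFDerivAt_profileGrad_fiber hk hz hw μ)).differentiableAt.mul
      ((hasFDerivAt_conj_coord μ w).differentiableAt.mul_const _)).congr_of_eventuallyEq h2
  have hc := (hasFDerivAt_coord μ w).differentiableAt
  rw [dzbar_congr h1, dzbar_mul (differentiableAt_const _) (hc.fun_mul hd), dzbar_mul hc hd,
    dzbar_const, dzbar_coord, dzbar_dz_energyC ht hk hz hw]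
  ring

/-- The mixed derivatives of the energy form a multiple of the row `μ` of the Levi matrix, so
contraction with the inverse leaves a Kronecker delta. -/
lemma chernFinsler_polydiskMetric (ht : 0 ≤ t) (hk : 2 ≤ k) (hz : z ∈ polydisk n) (hw : w ≠ 0)
    (α μ : Fin n) :
    chernFinsler (polydiskMetric n t k) α μ z w =
      if μ = α then 2 * conj (z μ) / (1 - ‖z μ‖ ^ 2) * w μ else 0 := by
  have hu : IsUnit (leviMatrix (polydiskMetric n t k) z w).det :=
    (Matrix.isUnit_iff_isUnit_det _).1 (posDef_leviMatrix ht hk hz hw).isUnit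
  have h := congrFun (congrFun (Matrix.mul_nonsing_inv _ hu) μ) α
  rw [Matrix.mul_apply, Matrix.one_apply] at h
  have h2 : chernFinsler (polydiskMetric n t k) α μ z w =
      2 * conj (z μ) / (1 - ‖z μ‖ ^ 2) * w μ *
        ∑ τ, leviMatrix (polydiskMetric n t k) z w μ τ *
          (leviMatrix (polydiskMetric n t k) z w)⁻¹ τ α := by
    rw [chernFinsler, Finset.mul_sum]
    refine Finset.sum_congr rfl fun τ _ => ?_
    rw [dzbar_dz_energyC_base ht hk hz hw]
    ring
  rw [h2, h]
  split_ifs <;> simp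

lemma horizontalChernFinsler_polydiskMetric (ht : 0 ≤ t) (hk : 2 ≤ k) (hz : z ∈ polydisk n)
    (hw : w ≠ 0) (α ν μ : Fin n) :
    horizontalChernFinsler (polydiskMetric n t k) α ν μ z w =
      if μ = α ∧ μ = ν then 2 * conj (z μ) / (1 - ‖z μ‖ ^ 2) else 0 := by
  have h1 : (fun v => chernFinsler (polydiskMetric n t k) α μ z v) =ᶠ[nhds w]
      fun v => (if μ = α then 2 * conj (z μ) / (1 - ‖z μ‖ ^ 2) else 0) * v μ := by
    filter_upwards [eventually_ne_zero hw] with v hv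
    rw [chernFinsler_polydiskMetric ht hk hz hv, ite_mul, zero_mul]
  rw [horizontalChernFinsler, dz_congr h1, dz_mul (differentiableAt_const _)
    (hasFDerivAt_coord μ w).differentiableAt, dz_const, dz_coord]
  by_cases h : μ = α <;> by_cases h' : μ = ν <;> simp [h, h']

theorem isKahlerBerwald_polydiskMetric (ht : 0 ≤ t) (hk : 2 ≤ k) :
    IsKahlerBerwald (polydisk n) (polydiskMetric n t k) := by
  refine ⟨⟨isStronglyPseudoconvex_polydiskMetric ht hk, fun z hz v hv α μ => ?_⟩,
    isStronglyPseudoconvex_polydiskMetric ht hk, fun z hz v w hv hw α ν μ => ?_⟩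
  · refine Finset.sum_eq_zero fun ν _ => ?_
    rw [horizontalChernFinsler_polydiskMetric ht hk hz hv,
      horizontalChernFinsler_polydiskMetric ht hk hz hv]
    by_cases h : μ = ν
    · subst h; simp
    · simp [h, Ne.symm h]
  · rw [horizontalChernFinsler_polydiskMetric ht hk hz hv,
      horizontalChernFinsler_polydiskMetric ht hk hz hw]

/-! ### Holomorphic sectional curvature -/

lemma hasFDerivAt_inv_one_sub_norm_sq (hz : z ∈ polydisk n) (α : Fin n) :
    HasFDerivAt (fun y : Fin n → ℂ => (1 - ‖y α‖ ^ 2)⁻¹)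
      ((2 / (1 - ‖z α‖ ^ 2) ^ 2) • (innerSL ℝ (z α)).comp
        (ContinuousLinearMap.proj α : (Fin n → ℂ) →L[ℝ] ℂ)) z := by
  have hpos := one_sub_norm_sq_pos hz α
  have h0 : HasDerivAt (fun x : ℝ => (1 - x)⁻¹) (1 / (1 - ‖z α‖ ^ 2) ^ 2) (‖z α‖ ^ 2) := by
    refine (((hasDerivAt_id (‖z α‖ ^ 2)).const_sub 1).inv (by simpa using hpos.ne')).congr_deriv ?_
    simp
  refine (h0.comp_hasFDerivAt z (hasFDerivAt_norm_sq_coord α z)).congr_fderiv ?_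
  rw [smul_smul]
  congr 1
  ring

lemma dzbar_inv_one_sub_norm_sq (hz : z ∈ polydisk n) (α μ : Fin n) :
    dzbar μ (fun y => (((1 - ‖y α‖ ^ 2)⁻¹ : ℝ) : ℂ)) z =
      if α = μ then z α / (1 - ‖z α‖ ^ 2) ^ 2 else 0 := by
  refine (dzbar_ofReal (hasFDerivAt_inv_one_sub_norm_sq hz α)).trans ?_
  by_cases h : α = μ
  · subst h
    simp only [smul_apply, ContinuousLinearMap.comp_apply,
      ContinuousLinearMap.proj_apply, Pi.single_eq_same, innerSL_apply_apply, inner_real_one,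
      inner_real_I, if_true, smul_eq_mul]
    push_cast
    linear_combination Complex.re_add_im (z α) / (1 - (‖z α‖ : ℂ) ^ 2) ^ 2
  · simp [h]

/-- The connection coefficient is complex linear in `v`, so the vertical part of `deltaBar`
vanishes. What remains is the `z̄`-derivative of `2 z̄ / (1 - |z|²)`, namely `2 / (1 - |z|²)²`. -/
lemma deltaBar_chernFinsler (ht : 0 ≤ t) (hk : 2 ≤ k) (hz : z ∈ polydisk n) (hw : w ≠ 0)
    (γ α μ : Fin n) :
    deltaBar (polydiskMetric n t k) μ (fun y v => chernFinsler (polydiskMetric n t k) γ α y v) z w =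
      if α = γ ∧ α = μ then 2 * w α / (1 - ‖z α‖ ^ 2) ^ 2 else 0 := by
  have h1 : (fun y => chernFinsler (polydiskMetric n t k) γ α y w) =ᶠ[nhds z]
      fun y => (if α = γ then 2 * w α else 0) *
        (conj (y α) * (((1 - ‖y α‖ ^ 2)⁻¹ : ℝ) : ℂ)) := by
    filter_upwards [isOpen_polydisk.mem_nhds hz] with y hy
    rw [chernFinsler_polydiskMetric ht hk hy hw]
    split_ifs
    · push_cast; ring
    · simp
  have h2 : (fun v => chernFinsler (polydiskMetric n t k) γ α z v) =ᶠ[nhds w]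
      fun v => (if α = γ then 2 * conj (z α) / (1 - ‖z α‖ ^ 2) else 0) * v α := by
    filter_upwards [eventually_ne_zero hw] with v hv
    rw [chernFinsler_polydiskMetric ht hk hz hv, ite_mul, zero_mul]
  have h3 : ∀ κ, dzbar κ (fun v => chernFinsler (polydiskMetric n t k) γ α z v) w = 0 := by
    intro κ
    rw [dzbar_congr h2, dzbar_mul (differentiableAt_const _)
      (hasFDerivAt_coord α w).differentiableAt, dzbar_const, dzbar_coord]
    ring
  have hc := (hasFDerivAt_conj_coord α z).differentiableAt
  have hi := (hasFDerivAt_ofReal (hasFDerivAt_inv_one_sub_norm_sq hz α)).differentiableAt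
  have hpos : (1 - (‖z α‖ : ℂ) ^ 2) ≠ 0 := by exact_mod_cast (one_sub_norm_sq_pos hz α).ne'
  simp only [deltaBar, h3, mul_zero, Finset.sum_const_zero, sub_zero]
  rw [dzbar_congr h1, dzbar_mul (differentiableAt_const _) (hc.fun_mul hi), dzbar_mul hc hi,
    dzbar_const, dzbar_conj_coord, dzbar_inv_one_sub_norm_sq hz]
  by_cases h : α = γ <;> by_cases h' : α = μ
  · simp only [h.symm, h'.symm, if_true, and_self]
    have : conj (z α) * z α = (‖z α‖ : ℂ) ^ 2 := Complex.conj_mul' _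
    push_cast
    field_simp
    linear_combination (2 * w α) * this
  · simp only [h', if_false, and_false]
    ring
  all_goals
    simp only [h, if_false, false_and]
    ring

lemma holSectCurvature_polydiskMetric (ht : 0 ≤ t) (hk : 2 ≤ k) (hz : z ∈ polydisk n)
    (hw : w ≠ 0) :
    holSectCurvature (polydiskMetric n t k) z w =
      ((-(4 * (∑ l, profileGrad t k (hypSq z w) l * hypSq z w l ^ 2) /
        profile t k (hypSq z w) ^ 2) : ℝ) : ℂ) := by
  have hterm : ∀ γ, ∑ α, ∑ μ, dz γ (energyC (polydiskMetric n t k) z) w *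
      deltaBar (polydiskMetric n t k) μ
        (fun y w => chernFinsler (polydiskMetric n t k) γ α y w) z w * w α * conj (w μ) =
      2 * (profileGrad t k (hypSq z w) γ * hypSq z w γ ^ 2 : ℝ) := by
    intro γ
    rw [Finset.sum_eq_single γ, Finset.sum_eq_single γ]
    · rw [deltaBar_chernFinsler ht hk hz hw, dz_energyC ht hk hz hw, if_pos ⟨rfl, rfl⟩, hypSq]
      push_cast
      rw [← Complex.mul_conj' (w γ)]
      ring
    · intro μ _ hμ
      rw [deltaBar_chernFinsler ht hk hz hw, if_neg fun h => hμ h.2.symm]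
      ring
    · simp
    · intro α _ hα
      refine Finset.sum_eq_zero fun μ _ => ?_
      rw [deltaBar_chernFinsler ht hk hz hw, if_neg fun h => hα h.1]
      ring
    · simp
  simp only [holSectCurvature, hterm, energyC, energy_polydiskMetric ht, ← Finset.mul_sum]
  push_cast
  ring

/-- One factor `a l` is bounded by the profile, and Euler's identity sums the rest. This is the
curvature bound `-4`. -/
lemma sum_profileGrad_mul_sq_le (ht : 0 ≤ t) (hk : 2 ≤ k) {a : Fin n → ℝ} (ha : ∀ l, 0 ≤ a l)
    (h0 : a ≠ 0) : ∑ l, profileGrad t k a l * a l ^ 2 ≤ profile t k a ^ 2 := by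
  calc ∑ l, profileGrad t k a l * a l ^ 2
      ≤ ∑ l, profileGrad t k a l * a l * profile t k a := by
        refine Finset.sum_le_sum fun l _ => ?_
        rw [sq, ← mul_assoc]
        exact mul_le_mul_of_nonneg_left (le_profile ht hk ha l)
          (mul_nonneg (profileGrad_pos ht k ha l).le (ha l))
    _ = _ := by rw [← Finset.sum_mul, sum_profileGrad_mul t hk (sum_pow_pos ha h0 k), sq]

/-- Power mean inequality with exponent `1 + 1 / k` for the numbers `a l ^ k`. -/
lemma rpow_sum_pow_sq_le (hk : 2 ≤ k) {a : Fin n → ℝ} (ha : ∀ l, 0 ≤ a l) (h0 : a ≠ 0) :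
    ((∑ l, a l ^ k) ^ ((1 : ℝ) / k)) ^ 2 ≤
      (n : ℝ) ^ ((1 : ℝ) / k) * ((∑ l, a l ^ k) ^ ((1 : ℝ) / k - 1) * ∑ l, a l ^ (k + 1)) := by
  have hS := sum_pow_pos ha h0 k
  have hk0 : (k : ℝ) ≠ 0 := by positivity
  have h := Real.rpow_sum_le_const_mul_sum_rpow_of_nonneg Finset.univ
    (p := 1 + (1 : ℝ) / k) (le_add_of_nonneg_right (by positivity))
    (f := fun l => a l ^ k) (fun l _ => pow_nonneg (ha l) k)
  have hpow : ∀ l, (a l ^ k) ^ (1 + (1 : ℝ) / k) = a l ^ (k + 1) := by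
    intro l
    rw [← Real.rpow_natCast, ← Real.rpow_mul (ha l), ← Real.rpow_natCast]
    congr 1
    push_cast
    field_simp
  simp only [hpow, Finset.card_univ, Fintype.card_fin, add_sub_cancel_left] at h
  calc ((∑ l, a l ^ k) ^ ((1 : ℝ) / k)) ^ 2
      = (∑ l, a l ^ k) ^ ((1 : ℝ) / k - 1) * (∑ l, a l ^ k) ^ (1 + (1 : ℝ) / k) := by
        rw [sq, ← Real.rpow_add hS, ← Real.rpow_add hS]
        congr 1
        ring
    _ ≤ (∑ l, a l ^ k) ^ ((1 : ℝ) / k - 1) *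
          ((n : ℝ) ^ ((1 : ℝ) / k) * ∑ l, a l ^ (k + 1)) := by gcongr
    _ = _ := by ring

/-- With `X`, `N` the `ℓ¹` and `ℓ^k` norms, the bounds `X² ≤ n A` and `N² ≤ m B` combine by
Cauchy-Schwarz to `(X + t N)² ≤ (n + t m)(A + t B)`. This is the upper curvature bound. -/
lemma profile_sq_le (ht : 0 ≤ t) (hk : 2 ≤ k) {a : Fin n → ℝ} (ha : ∀ l, 0 ≤ a l)
    (h0 : a ≠ 0) : (1 + t) * profile t k a ^ 2 ≤
      (n + t * (n : ℝ) ^ ((1 : ℝ) / k)) * ∑ l, profileGrad t k a l * a l ^ 2 := by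
  have hS := sum_pow_pos ha h0 k
  have hX : (∑ l, a l) ^ 2 ≤ n * ∑ l, a l ^ 2 := by
    simpa using sq_sum_le_card_mul_sum_sq (s := Finset.univ) (f := a)
  have hN := rpow_sum_pow_sq_le hk ha h0
  have hgrad : ∑ l, profileGrad t k a l * a l ^ 2 = (∑ l, a l ^ 2 +
      t * ((∑ l, a l ^ k) ^ ((1 : ℝ) / k - 1) * ∑ l, a l ^ (k + 1))) / (1 + t) := by
    rw [Finset.mul_sum, Finset.mul_sum, ← Finset.sum_add_distrib, Finset.sum_div]
    refine Finset.sum_congr rfl fun l _ => ?_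
    obtain ⟨m, rfl⟩ := Nat.exists_eq_add_of_le' hk
    simp only [profileGrad, show m + 2 - 1 = m + 1 by omega]
    ring
  rw [hgrad, profile]
  set X := ∑ l, a l
  set N := (∑ l, a l ^ k) ^ ((1 : ℝ) / k)
  set A := ∑ l, a l ^ 2
  set m := (n : ℝ) ^ ((1 : ℝ) / k)
  set B := (∑ l, a l ^ k) ^ ((1 : ℝ) / k - 1) * ∑ l, a l ^ (k + 1)
  have hA : 0 ≤ A := by positivity
  have hB : 0 ≤ B := mul_nonneg (by positivity) (Finset.sum_nonneg fun l _ => pow_nonneg (ha l) _)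
  have hm : 0 ≤ m := by positivity
  have hn : (0 : ℝ) ≤ n := by positivity
  -- `4 X² N² ≤ 4 (n A)(m B) ≤ (n B + m A)²` by the inequality of arithmetic and geometric means.
  have hcross : 2 * (X * N) ≤ n * B + m * A := by
    refine le_of_sq_le_sq ?_ (by positivity)
    have : X ^ 2 * N ^ 2 ≤ (n * A) * (m * B) := by gcongr
    nlinarith [sq_nonneg (n * B - m * A)]
  have h1 : 0 < 1 + t := by linarith
  rw [div_pow, ← mul_div_assoc, ← mul_div_assoc, div_le_div_iff₀ (by positivity) h1]
  have hmain : (X + t * N) ^ 2 ≤ (n + t * m) * (A + t * B) := by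
    nlinarith [mul_le_mul_of_nonneg_left hcross ht, mul_le_mul_of_nonneg_left hN (mul_nonneg ht ht)]
  calc (1 + t) * (X + t * N) ^ 2 * (1 + t) = (X + t * N) ^ 2 * (1 + t) ^ 2 := by ring
    _ ≤ _ := by gcongr

theorem holSectCurvature_mem_Icc (ht : 0 ≤ t) (hk : 2 ≤ k) (hz : z ∈ polydisk n)
    (hw : w ≠ 0) : ∃ K : ℝ, holSectCurvature (polydiskMetric n t k) z w = K ∧
      K ∈ Set.Icc (-4 : ℝ) (-(4 * (1 + t) / (n + t * (n : ℝ) ^ ((1 : ℝ) / k)))) := by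
  refine ⟨_, holSectCurvature_polydiskMetric ht hk hz hw, ?_, ?_⟩
  all_goals
    have ha := hypSq_nonneg z w
    have h0 := hypSq_ne_zero hz hw
    have hp := profile_pos ht hk ha h0
  · rw [neg_le_neg_iff, div_le_iff₀ (by positivity)]
    have := sum_profileGrad_mul_sq_le ht hk ha h0
    linarith
  · have hn : (0 : ℝ) < n := by
      obtain ⟨l, -⟩ := Function.ne_iff.1 hw
      exact_mod_cast l.pos
    rw [neg_le_neg_iff, div_le_div_iff₀ (by positivity) (by positivity)]
    have := profile_sq_le ht hk ha h0
    linarith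

end

section

variable {n : ℕ} {t : ℝ} {k : ℕ} {z w : Fin n → ℂ}

/-! ### Geodesics -/

/-- If `p`, `v`, `w` are the position, the velocity and the acceleration of a curve in the unit
disk, the curve is a geodesic of the Poincaré metric when this expression vanishes. -/
noncomputable def poincareEulerLagrange (p v w : ℂ) : ℂ :=
  (1 / (1 - ‖p‖ ^ 2) ^ 2) • w + (4 * inner ℝ p v / (1 - ‖p‖ ^ 2) ^ 3) • v -
    (2 * ‖v‖ ^ 2 / (1 - ‖p‖ ^ 2) ^ 3) • p

lemma hasDerivWithinAt_hypSq_component {c d : ℝ → ℂ} {v w : ℂ} {I : Set ℝ} {s : ℝ}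
    (hc : HasDerivWithinAt c v I s) (hd : HasDerivWithinAt d w I s) (hv : d s = v)
    (hpos : 0 < 1 - ‖c s‖ ^ 2) :
    HasDerivWithinAt (fun r => ‖d r‖ ^ 2 / (1 - ‖c r‖ ^ 2) ^ 2)
      (2 * inner ℝ v (poincareEulerLagrange (c s) v w)) I s := by
  refine (hd.norm_sq.div ((hc.norm_sq.const_sub 1).pow 2) (pow_pos hpos 2).ne').congr_deriv ?_
  subst hv
  simp only [poincareEulerLagrange, inner_sub_right, inner_add_right, inner_smul_right,
    real_inner_comm (d s) (c s), real_inner_self_eq_norm_sq, Pi.pow_apply]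
  field_simp
  ring

/-- The last summand is the base derivative of the squared Poincaré norm in the direction `e`, so
`poincareEulerLagrange` is half the defect in the Euler-Lagrange equation of the disk. -/
lemma hasDerivWithinAt_momentum {c d : ℝ → ℂ} {v w : ℂ} {I : Set ℝ} {s : ℝ}
    (hc : HasDerivWithinAt c v I s) (hd : HasDerivWithinAt d w I s) (hv : d s = v)
    (hpos : 0 < 1 - ‖c s‖ ^ 2) (e : ℂ) :
    HasDerivWithinAt (fun r => 2 / (1 - ‖c r‖ ^ 2) ^ 2 * inner ℝ (d r) e)
      (2 * inner ℝ (poincareEulerLagrange (c s) v w) e +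
        4 * ‖v‖ ^ 2 / (1 - ‖c s‖ ^ 2) ^ 3 * inner ℝ (c s) e) I s := by
  have h1 := (hasDerivWithinAt_const s I (2 : ℝ)).div
    ((hc.norm_sq.const_sub 1).pow 2) (pow_pos hpos 2).ne'
  have h2 := hd.inner ℝ (hasDerivWithinAt_const s I e)
  refine (h1.mul h2).congr_deriv ?_
  subst hv
  simp only [poincareEulerLagrange, inner_sub_left, inner_add_left, inner_smul_left, Pi.pow_apply,
    Pi.div_apply, inner_zero_right, conj_trivial]
  field_simp
  ring

/-- Multiplying the `l`-th equation by `b l / (2 * a l)` and summing equates a sum of nonnegative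
terms with minus the Hessian form at `b`, which is nonpositive by convexity; so all terms vanish. If
`a l = 0`, the equation itself gives `b l = 0`, and division by zero contributes `0`. -/
lemma eq_zero_of_profileGrad_mul_add (ht : 0 ≤ t) (hk : 2 ≤ k) {a b : Fin n → ℝ}
    (ha : ∀ l, 0 ≤ a l) (hS : 0 < ∑ l, a l ^ k)
    (h : ∀ l, profileGrad t k a l * b l + 2 * profileGradDeriv t k a l b * a l = 0) : b = 0 := by
  have hb : ∀ l, a l = 0 → b l = 0 := by
    intro l hl
    have := h l
    rw [hl, mul_zero, add_zero] at this
    exact (mul_eq_zero.1 this).resolve_left (profileGrad_pos ht k ha l).ne'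
  have hterm : ∀ l, profileGrad t k a l * b l ^ 2 / (2 * a l) =
      -(profileGradDeriv t k a l b * b l) := by
    intro l
    by_cases hl : a l = 0
    · simp [hb l hl]
    · rw [div_eq_iff (by simpa using hl)]
      linear_combination b l * h l
  have hle : ∑ l, profileGrad t k a l * b l ^ 2 / (2 * a l) ≤ 0 := by
    rw [Finset.sum_congr rfl fun l _ => hterm l, Finset.sum_neg_distrib, neg_nonpos]
    refine (profileHess_nonneg ht hk ha hS b).trans_eq ?_
    rw [Finset.sum_comm]
    simp only [profileGradDeriv_apply, Finset.sum_mul]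
  have hnn : ∀ l ∈ Finset.univ, 0 ≤ profileGrad t k a l * b l ^ 2 / (2 * a l) := fun l _ =>
    div_nonneg (mul_nonneg (profileGrad_pos ht k ha l).le (sq_nonneg _)) (by linarith [ha l])
  have hz := (Finset.sum_eq_zero_iff_of_nonneg hnn).1 (le_antisymm hle (Finset.sum_nonneg hnn))
  funext l
  by_cases hl : a l = 0
  · exact hb l hl
  · have := hz l (Finset.mem_univ l)
    rw [div_eq_zero_iff] at this
    rcases this with h1 | h1
    · simpa using (mul_eq_zero.1 h1).resolve_left (profileGrad_pos ht k ha l).ne'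
    · exact absurd h1 (by simpa using hl)

lemma uniqueDiffOn_of_ordConnected {I : Set ℝ} (hI : I.OrdConnected) (hI' : I.Nontrivial) :
    UniqueDiffOn ℝ I :=
  uniqueDiffOn_convex hI.convex (hI.convex.nontrivial_iff_nonempty_interior.1 hI')

/-- The equations for component `l` say that the momentum defect `E l`, weighted by the partial
derivative of the profile, cancels a multiple of the velocity coming from the change of that weight.
The multiple turns out to vanish because the component speeds are constant. -/
lemma eulerLagrange_iff (ht : 0 ≤ t) (hk : 2 ≤ k) {I : Set ℝ} {c d : ℝ → Fin n → ℂ}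
    {w : Fin n → ℂ} {s : ℝ} (hs : s ∈ I) (hI : UniqueDiffWithinAt ℝ I s)
    (hcI : Set.MapsTo c I (polydisk n)) (hdI : ∀ r ∈ I, d r ≠ 0)
    (hc : HasDerivWithinAt c (d s) I s) (hd : HasDerivWithinAt d w I s) :
    (∀ a : Fin n ⊕ Fin n, HasDerivWithinAt
        (fun r => fderiv ℝ (fun w => energy (polydiskMetric n t k) (c r) w) (d r) (realBasisVec a))
        (fderiv ℝ (fun y => energy (polydiskMetric n t k) y (d s)) (c s) (realBasisVec a)) I s) ↔
      ∀ l, poincareEulerLagrange (c s l) (d s l) (w l) = 0 := by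
  have hpos := one_sub_norm_sq_pos (hcI hs)
  have hcl : ∀ l, HasDerivWithinAt (fun r => c r l) (d s l) I s := hasDerivWithinAt_pi.1 hc
  have hdl : ∀ l, HasDerivWithinAt (fun r => d r l) (w l) I s := hasDerivWithinAt_pi.1 hd
  set E : Fin n → ℂ := fun l => poincareEulerLagrange (c s l) (d s l) (w l) with hE
  set a : Fin n → ℝ := hypSq (c s) (d s) with ha
  set b : Fin n → ℝ := fun l => 2 * inner ℝ (d s l) (E l) with hb
  have hS : 0 < ∑ l, a l ^ k := sum_hypSq_pow_pos (hcI hs) (hdI s hs) k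
  have hab : HasDerivWithinAt (fun r => hypSq (c r) (d r)) b I s :=
    hasDerivWithinAt_pi.2 fun l => hasDerivWithinAt_hypSq_component (hcl l) (hdl l) rfl (hpos l)
  have hg : ∀ l, HasDerivWithinAt (fun r => profileGrad t k (hypSq (c r) (d r)) l)
      (profileGradDeriv t k a l b) I s := fun l =>
    HasFDerivAt.comp_hasDerivWithinAt (l := fun a => profileGrad t k a l) s (hasFDerivAt_profileGrad t hk hS l) hab
  have key : ∀ (l : Fin n) (e : ℂ), (∀ r ∈ I,
      fderiv ℝ (fun w => energy (polydiskMetric n t k) (c r) w) (d r) (Pi.single l e) =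
        profileGrad t k (hypSq (c r) (d r)) l *
          (2 / (1 - ‖c r l‖ ^ 2) ^ 2 * inner ℝ (d r l) e)) := by
    intro l e r hr
    have := (hasFDerivAt_energy_fiber ht hk (hcI hr) (hdI r hr)).fderiv
    rw [show (fun w => energy (polydiskMetric n t k) (c r) w) =
      energy (polydiskMetric n t k) (c r) from rfl, this, ContinuousLinearMap.comp_apply,
      hypSqFiberDeriv_single, profileDeriv_single]
  have keyIff : ∀ (l : Fin n) (e : ℂ), HasDerivWithinAt
        (fun r => fderiv ℝ (fun w => energy (polydiskMetric n t k) (c r) w) (d r) (Pi.single l e))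
        (fderiv ℝ (fun y => energy (polydiskMetric n t k) y (d s)) (c s) (Pi.single l e)) I s ↔
      inner ℝ ((profileGradDeriv t k a l b / (1 - ‖c s l‖ ^ 2) ^ 2) • d s l +
        profileGrad t k a l • E l) e = 0 := by
    intro l e
    have hder := (hg l).mul
      (hasDerivWithinAt_momentum (hcl l) (hdl l) rfl (hpos l) e)
    have hder' : HasDerivWithinAt
        (fun r => fderiv ℝ (fun w => energy (polydiskMetric n t k) (c r) w) (d r) (Pi.single l e))
        _ I s := hder.congr (fun r hr => key l e r hr) (key l e s hs)
    rw [(hasFDerivAt_energy_base ht hk (hcI hs) (hdI s hs)).fderiv, ContinuousLinearMap.comp_apply,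
      hypSqBaseDeriv_single, profileDeriv_single, inner_add_left, inner_smul_left, inner_smul_left]
    simp only [conj_trivial]
    constructor
    · intro h
      have := hI.eq_deriv _ h hder'
      linear_combination -this / 2
    · intro h
      refine hder'.congr_deriv ?_
      linear_combination 2 * h
  have hvec : (∀ a : Fin n ⊕ Fin n, HasDerivWithinAt
        (fun r => fderiv ℝ (fun w => energy (polydiskMetric n t k) (c r) w) (d r) (realBasisVec a))
        (fderiv ℝ (fun y => energy (polydiskMetric n t k) y (d s)) (c s) (realBasisVec a)) I s) ↔
      ∀ l, (profileGradDeriv t k a l b / (1 - ‖c s l‖ ^ 2) ^ 2) • d s l +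
        profileGrad t k a l • E l = 0 := by
    rw [Sum.forall]
    simp only [realBasisVec, keyIff]
    rw [← forall_and]
    refine forall_congr' fun l => ?_
    rw [inner_real_one, inner_real_I]
    exact ⟨fun h => Complex.ext h.1 h.2, fun h => by rw [h]; exact ⟨rfl, rfl⟩⟩
  rw [hvec]
  constructor
  · intro h
    have hb0 : b = 0 := by
      refine eq_zero_of_profileGrad_mul_add ht hk (hypSq_nonneg _ _) hS fun l => ?_
      -- Pairing with the velocity turns the vector equation into one for `a` and its derivative
      -- `b`.
      have h1 := congrArg (fun x => inner ℝ (d s l) x) (h l)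
      simp only [inner_add_right, inner_smul_right, inner_zero_right,
        real_inner_self_eq_norm_sq] at h1
      simp only [hb, hypSq]
      simp only [hb, ha] at h1
      linear_combination 2 * h1
    intro l
    have h2 := h l
    rw [hb0, map_zero, zero_div, zero_smul, zero_add, smul_eq_zero] at h2
    exact h2.resolve_left (profileGrad_pos ht k (hypSq_nonneg _ _) l).ne'
  · intro h l
    have hb0 : b = 0 := by funext l; simp [hb, hE, h l]
    rw [hb0, map_zero, zero_div, zero_smul, zero_add, show E l = 0 from h l, smul_zero]

lemma isGeodesicOn_polydiskMetric_iff (ht : 0 ≤ t) (hk : 2 ≤ k) {I : Set ℝ}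
    (hI : I.OrdConnected) (hI' : I.Nontrivial) (γ : ℝ → Fin n → ℂ) :
    IsGeodesicOn (polydisk n) (polydiskMetric n t k) I γ ↔
      ContDiffOn ℝ 2 γ I ∧ Set.MapsTo γ I (polydisk n) ∧ (∀ s ∈ I, derivWithin γ I s ≠ 0) ∧
        ∀ s ∈ I, ∀ l, poincareEulerLagrange (γ s l) (derivWithin γ I s l)
          (derivWithin (derivWithin γ I) I s l) = 0 := by
  have hu := uniqueDiffOn_of_ordConnected hI hI'
  refine and_congr_right fun h2 => and_congr_right fun hmap => and_congr_right fun hne => ?_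
  refine forall₂_congr fun s hs => ?_
  have hd2 : ContDiffOn ℝ 1 (derivWithin γ I) I := h2.derivWithin hu (by norm_num)
  exact eulerLagrange_iff ht hk hs (hu s hs) hmap hne
    ((h2.differentiableOn (by norm_num)) s hs).hasDerivWithinAt
    ((hd2.differentiableOn (by norm_num)) s hs).hasDerivWithinAt

/-- The Bergman metric belongs to the family, so the geodesic criterion, which is free of `t`,
applies to it as well. -/
lemma bergmanMetric_eq (n k : ℕ) : bergmanMetric n = polydiskMetric n 0 k := by
  funext z v
  simp [bergmanMetric, polydiskMetric]

theorem isGeodesicOn_polydiskMetric_iff_bergmanMetric (ht : 0 ≤ t) (hk : 2 ≤ k) {I : Set ℝ}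
    (hI : I.OrdConnected) (hI' : I.Nontrivial) (γ : ℝ → Fin n → ℂ) :
    IsGeodesicOn (polydisk n) (polydiskMetric n t k) I γ ↔
      IsGeodesicOn (polydisk n) (bergmanMetric n) I γ := by
  rw [bergmanMetric_eq n k, isGeodesicOn_polydiskMetric_iff ht hk hI hI',
    isGeodesicOn_polydiskMetric_iff le_rfl hk hI hI']

end

section

variable {n : ℕ} {t : ℝ} {k : ℕ}

/-! ### Möbius transformations -/

/-- The automorphism of the unit disk that moves `0` to `p` and has positive derivative there. -/
noncomputable def mobius (p z : ℂ) : ℂ := (z + p) / (1 + conj p * z)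

lemma mobius_denom_ne_zero {p z : ℂ} (hp : ‖p‖ < 1) (hz : ‖z‖ < 1) : 1 + conj p * z ≠ 0 := by
  intro h
  have h1 : conj p * z = -1 := by linear_combination h
  have h2 := congrArg norm h1
  rw [norm_mul, RCLike.norm_conj, norm_neg, norm_one] at h2
  nlinarith [norm_nonneg p, norm_nonneg z]

lemma norm_sq_mobius_denom_sub (p z : ℂ) :
    ‖1 + conj p * z‖ ^ 2 - ‖z + p‖ ^ 2 = (1 - ‖p‖ ^ 2) * (1 - ‖z‖ ^ 2) := by
  simp only [Complex.sq_norm, Complex.normSq_apply, Complex.add_re, Complex.add_im, Complex.mul_re,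
    Complex.mul_im, Complex.conj_re, Complex.conj_im, Complex.one_re, Complex.one_im]
  ring

lemma one_sub_norm_sq_mobius {p z : ℂ} (hp : ‖p‖ < 1) (hz : ‖z‖ < 1) :
    1 - ‖mobius p z‖ ^ 2 = (1 - ‖p‖ ^ 2) * (1 - ‖z‖ ^ 2) / ‖1 + conj p * z‖ ^ 2 := by
  have h := norm_ne_zero_iff.2 (mobius_denom_ne_zero hp hz)
  rw [mobius, norm_div, div_pow, ← norm_sq_mobius_denom_sub, sub_div, div_self (pow_ne_zero 2 h)]

lemma norm_mobius_lt_one {p z : ℂ} (hp : ‖p‖ < 1) (hz : ‖z‖ < 1) : ‖mobius p z‖ < 1 := by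
  have h := norm_pos_iff.2 (mobius_denom_ne_zero hp hz)
  have h1 := one_sub_norm_sq_mobius hp hz
  have h2 : 0 < 1 - ‖p‖ ^ 2 := by nlinarith [norm_nonneg p]
  have h3 : 0 < 1 - ‖z‖ ^ 2 := by nlinarith [norm_nonneg z]
  have h4 : 0 < 1 - ‖mobius p z‖ ^ 2 := by rw [h1]; positivity
  nlinarith [norm_nonneg (mobius p z)]

lemma hasDerivAt_mobius {p z : ℂ} (hp : ‖p‖ < 1) (hz : ‖z‖ < 1) :
    HasDerivAt (mobius p) ((1 - ‖p‖ ^ 2) / (1 + conj p * z) ^ 2) z := by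
  have h := mobius_denom_ne_zero hp hz
  have h1 : HasDerivAt (fun z : ℂ => 1 + conj p * z) (conj p) z := by
    simpa using ((hasDerivAt_id z).const_mul (conj p)).const_add 1
  refine (((hasDerivAt_id z).add_const p).div h1 h).congr_deriv ?_
  rw [← Complex.conj_mul']
  simp only [id]
  congr 1
  ring

/-- The product of Möbius transformations. -/
noncomputable def mobiusPi (p z : Fin n → ℂ) (l : Fin n) : ℂ := mobius (p l) (z l)

lemma mobiusPi_mem {p z : Fin n → ℂ} (hp : p ∈ polydisk n) (hz : z ∈ polydisk n) :
    mobiusPi p z ∈ polydisk n := fun l => norm_mobius_lt_one (hp l) (hz l)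

lemma neg_mem_polydisk {p : Fin n → ℂ} (hp : p ∈ polydisk n) : -p ∈ polydisk n := fun l => by
  simpa using hp l

lemma zero_mem_polydisk : (0 : Fin n → ℂ) ∈ polydisk n := fun l => by simp

lemma hasFDerivAt_mobiusPi {p z : Fin n → ℂ} (hp : p ∈ polydisk n) (hz : z ∈ polydisk n) :
    HasFDerivAt (𝕜 := ℂ) (mobiusPi p) (ContinuousLinearMap.pi fun l =>
      ((1 - ‖p l‖ ^ 2 : ℂ) / (1 + conj (p l) * z l) ^ 2) •
        (ContinuousLinearMap.proj l : (Fin n → ℂ) →L[ℂ] ℂ)) z :=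
  hasFDerivAt_pi.2 fun l =>
    (hasDerivAt_mobius (hp l) (hz l)).comp_hasFDerivAt z (hasFDerivAt_apply l z)

/-! ### Invariance under automorphisms -/

lemma polydisk_eq_ball (n : ℕ) : polydisk n = Metric.ball 0 1 := by
  ext z
  rw [mem_ball_zero_iff, pi_norm_lt_iff one_pos]
  rfl

/-- Schwarz lemma in the supremum norm. Composing `f` with Möbius maps taking `0` to `z` and `f z`
to `0` gives a self-map of the unit ball fixing `0`; the Möbius differentials supply the factors `1
- |z_j|²` and `1 / (1 - |f(z)_l|²)`. -/
lemma norm_fderiv_mul_le {f : (Fin n → ℂ) → Fin n → ℂ} (hf : DifferentiableOn ℂ f (polydisk n))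
    (hmaps : Set.MapsTo f (polydisk n) (polydisk n)) {z : Fin n → ℂ} (hz : z ∈ polydisk n)
    (u : Fin n → ℂ) :
    ‖fun l => fderiv ℂ f z (fun j => (1 - ‖z j‖ ^ 2 : ℂ) * u j) l / (1 - ‖f z l‖ ^ 2 : ℂ)‖ ≤ ‖u‖ := by
  have hfz := hmaps hz
  set g := mobiusPi (-f z) ∘ f ∘ mobiusPi z with hg
  have hg1 : HasFDerivAt (𝕜 := ℂ) (mobiusPi z) _ 0 := hasFDerivAt_mobiusPi hz zero_mem_polydisk
  have hz0 : mobiusPi z 0 = z := by funext l; simp [mobiusPi, mobius]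
  have hg2 : HasFDerivAt f (fderiv ℂ f z) (mobiusPi z 0) := by
    rw [hz0]
    exact (hf.differentiableAt (isOpen_polydisk.mem_nhds hz)).hasFDerivAt
  have hm := hasFDerivAt_mobiusPi (neg_mem_polydisk hfz) hfz
  have hg3 : HasFDerivAt (mobiusPi (-f z)) (fderiv ℂ (mobiusPi (-f z)) (f z))
      ((f ∘ mobiusPi z) 0) := by
    rw [Function.comp_apply, hz0]
    exact hm.differentiableAt.hasFDerivAt
  have hgd := hg3.comp 0 (hg2.comp 0 hg1)
  have hdiff : DifferentiableOn ℂ g (Metric.ball 0 1) := by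
    rw [← polydisk_eq_ball]
    intro y hy
    have h1 := (hasFDerivAt_mobiusPi hz hy).differentiableAt
    have h2 := hf.differentiableAt (isOpen_polydisk.mem_nhds (mobiusPi_mem hz hy))
    have h3 := (hasFDerivAt_mobiusPi (neg_mem_polydisk hfz)
      (hmaps (mobiusPi_mem hz hy))).differentiableAt
    exact (h3.comp y (h2.comp y h1)).differentiableWithinAt
  have hg0 : g 0 = 0 := by
    simp only [hg, Function.comp_apply, hz0]
    funext l
    simp [mobiusPi, mobius]
  have hmapsg : Set.MapsTo g (Metric.ball 0 1) (Metric.ball (g 0) 1) := by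
    rw [hg0, ← polydisk_eq_ball]
    exact fun y hy => mobiusPi_mem (neg_mem_polydisk hfz) (hmaps (mobiusPi_mem hz hy))
  have hle := Complex.norm_fderiv_le_one_of_mapsTo_ball hdiff
    (hmapsg.mono_right Metric.ball_subset_closedBall) one_pos
  have hval : fderiv ℂ g 0 u =
      fun l => fderiv ℂ f z (fun j => (1 - ‖z j‖ ^ 2 : ℂ) * u j) l / (1 - ‖f z l‖ ^ 2 : ℂ) := by
    rw [hgd.fderiv, hm.fderiv]
    funext l
    have hpos : (1 - (‖f z l‖ : ℂ) ^ 2) ≠ 0 := by exact_mod_cast (one_sub_norm_sq_pos hfz l).ne'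
    have h1 : 1 + conj (-f z l) * f z l = 1 - (‖f z l‖ : ℂ) ^ 2 := by
      rw [← Complex.conj_mul', map_neg]; ring
    simp only [ContinuousLinearMap.comp_apply, ContinuousLinearMap.coe_pi', smul_apply,
      ContinuousLinearMap.proj_apply, Pi.neg_apply, norm_neg, smul_eq_mul, h1, Pi.zero_apply,
      mul_zero, add_zero, one_pow, div_one]
    rw [show (∀ (w : Fin n → ℂ), (1 - (‖f z l‖ : ℂ) ^ 2) / (1 - (‖f z l‖ : ℂ) ^ 2) ^ 2 *
      fderiv ℂ f z w l = fderiv ℂ f z w l / (1 - (‖f z l‖ : ℂ) ^ 2)) from fun w => by field_simp]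
  rw [← hval]
  calc ‖fderiv ℂ g 0 u‖ ≤ ‖fderiv ℂ g 0‖ * ‖u‖ := ContinuousLinearMap.le_opNorm _ _
    _ ≤ 1 * ‖u‖ := by gcongr
    _ = ‖u‖ := one_mul _

lemma linearMap_apply_eq_sum (A : (Fin n → ℂ) →ₗ[ℂ] (Fin n → ℂ)) (v : Fin n → ℂ) (i : Fin n) :
    A v i = ∑ j, v j * A (Pi.single j 1) i := by
  conv_lhs => rw [← Finset.univ_sum_single v]
  simp only [map_sum, Finset.sum_apply]
  refine Finset.sum_congr rfl fun j _ => ?_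
  rw [show (Pi.single j (v j) : Fin n → ℂ) = v j • Pi.single j 1 by
    rw [← Pi.single_smul, smul_eq_mul, mul_one], map_smul]
  rfl

lemma sum_norm_le_one_of_norm_le {A : (Fin n → ℂ) →ₗ[ℂ] (Fin n → ℂ)} (hA : ∀ u, ‖A u‖ ≤ ‖u‖)
    (i : Fin n) : ∑ j, ‖A (Pi.single j 1) i‖ ≤ 1 := by
  set c : Fin n → ℂ := fun j => A (Pi.single j 1) i
  -- Phases aligned with the row `c`; an entry with `c j = 0` becomes `0`.
  set u : Fin n → ℂ := fun j => conj (c j) / ‖c j‖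
  have hu : ‖u‖ ≤ 1 := by
    refine (pi_norm_le_iff_of_nonneg zero_le_one).2 fun j => ?_
    simp only [u, norm_div, RCLike.norm_conj, Complex.norm_real, norm_norm]
    exact div_self_le_one _
  have h1 : A u i = ((∑ j, ‖c j‖ : ℝ) : ℂ) := by
    rw [linearMap_apply_eq_sum]
    push_cast
    refine Finset.sum_congr rfl fun j _ => ?_
    change conj (c j) / ‖c j‖ * c j = ‖c j‖
    by_cases h : c j = 0
    · simp [h]
    · have : (‖c j‖ : ℂ) ≠ 0 := by simpa using h
      rw [div_mul_eq_mul_div, Complex.conj_mul', sq, mul_div_assoc, div_self this, mul_one]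
  have h2 : ‖A u i‖ ≤ 1 := (norm_le_pi_norm _ i).trans ((hA u).trans hu)
  rw [h1, Complex.norm_real] at h2
  exact (le_abs_self _).trans h2

/-- The linear isometries of `ℂⁿ` with the supremum norm permute the absolute values of the
coordinates. -/
lemma exists_perm_of_norm_le {A B : (Fin n → ℂ) →ₗ[ℂ] (Fin n → ℂ)} (hA : ∀ u, ‖A u‖ ≤ ‖u‖)
    (hB : ∀ u, ‖B u‖ ≤ ‖u‖) (hAB : ∀ u, A (B u) = u) (hBA : ∀ u, B (A u) = u) :
    ∃ σ : Equiv.Perm (Fin n), ∀ v i, ‖A v i‖ = ‖v (σ i)‖ := by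
  have hBle : ∀ i j, ‖B (Pi.single i 1) j‖ ≤ 1 := fun i j =>
    (norm_le_pi_norm _ j).trans ((hB _).trans (by
      refine (pi_norm_le_iff_of_nonneg zero_le_one).2 fun l => ?_
      by_cases h : l = i
      · subst h; simp
      · simp [h]))
  -- Otherwise the `(i, i)` entry of `AB = 1` would be strictly smaller in modulus than a row sum of
  -- `A`, which is at most `1`.
  have hex : ∀ i, ∃ j, ‖B (Pi.single i 1) j‖ = 1 := by
    intro i
    by_contra! hne
    have hlt : ∀ j, ‖B (Pi.single i 1) j‖ < 1 := fun j => lt_of_le_of_ne (hBle i j) (hne j)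
    have h1 : ∑ j, B (Pi.single i 1) j * A (Pi.single j 1) i = 1 := by
      rw [← linearMap_apply_eq_sum, hAB, Pi.single_eq_same]
    have hexA : ∃ j, A (Pi.single j 1) i ≠ 0 := by
      by_contra! h0
      simp [h0] at h1
    obtain ⟨j₀, hj₀⟩ := hexA
    have h2 : (1 : ℝ) < 1 := by
      calc (1 : ℝ) = ‖∑ j, B (Pi.single i 1) j * A (Pi.single j 1) i‖ := by rw [h1, norm_one]
        _ ≤ ∑ j, ‖B (Pi.single i 1) j * A (Pi.single j 1) i‖ := norm_sum_le _ _
        _ < ∑ j, ‖A (Pi.single j 1) i‖ := by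
          refine Finset.sum_lt_sum (fun j _ => ?_) ⟨j₀, Finset.mem_univ _, ?_⟩
          · rw [norm_mul]
            exact mul_le_of_le_one_left (norm_nonneg _) (hBle i j)
          · rw [norm_mul]
            exact mul_lt_of_lt_one_left (norm_pos_iff.2 hj₀) (hlt j₀)
        _ ≤ 1 := sum_norm_le_one_of_norm_le hA i
    exact lt_irrefl _ h2
  choose σ hσ using hex
  have hnorm : ∀ v i, ‖A v i‖ = ‖v (σ i)‖ := by
    intro v i
    -- The row `σ i` of `B` has absolute sum at most `1` and already contains an entry of modulus
    -- `1`.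
    have hzero : ∀ i', i' ≠ i → B (Pi.single i' 1) (σ i) = 0 := by
      intro i' hi'
      have hs := sum_norm_le_one_of_norm_le hB (σ i)
      have hp : ‖B (Pi.single i' 1) (σ i)‖ + ‖B (Pi.single i 1) (σ i)‖ ≤
          ∑ j, ‖B (Pi.single j 1) (σ i)‖ := by
        rw [← Finset.sum_pair (f := fun j => ‖B (Pi.single j 1) (σ i)‖) hi']
        exact Finset.sum_le_sum_of_subset_of_nonneg (Finset.subset_univ _)
          fun _ _ _ => norm_nonneg _
      rw [hσ] at hp
      exact norm_le_zero_iff.1 (by linarith)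
    have hv : v (σ i) = A v i * B (Pi.single i 1) (σ i) := by
      conv_lhs => rw [← hBA v, linearMap_apply_eq_sum B]
      refine Finset.sum_eq_single i (fun j _ hj => ?_) (by simp)
      rw [hzero j hj, mul_zero]
    rw [hv, norm_mul, hσ, mul_one]
  have hinj : Function.Injective σ := by
    intro i i' h
    by_contra hne
    have h1 := hnorm (B (Pi.single i 1)) i
    have h2 := hnorm (B (Pi.single i 1)) i'
    rw [hAB] at h1 h2
    rw [← h, ← h1] at h2
    simp [Ne.symm hne] at h2
  exact ⟨Equiv.ofBijective σ (Finite.injective_iff_bijective.1 hinj), hnorm⟩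

lemma profile_comp_perm (t : ℝ) (k : ℕ) (a : Fin n → ℝ) (σ : Equiv.Perm (Fin n)) :
    profile t k (fun l => a (σ l)) = profile t k a := by
  rw [profile, profile, Equiv.sum_comp σ a, Equiv.sum_comp σ fun l => a l ^ k]

theorem isAutInvariant_polydiskMetric (ht : 0 ≤ t) (k : ℕ) :
    IsAutInvariant (polydisk n) (polydiskMetric n t k) := by
  rintro f ⟨g, hf, hg, hinv, hfd, hgd⟩ z hz v
  have hfz := hf hz
  have hh : ∀ {y : Fin n → ℂ}, y ∈ polydisk n → ∀ l, (1 - (‖y l‖ : ℂ) ^ 2) ≠ 0 := fun hy l => by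
    exact_mod_cast (one_sub_norm_sq_pos hy l).ne'
  -- `T y` normalizes tangent vectors at `y` so that the moduli of the coordinates become the
  -- Poincaré norms; `S y` is its inverse.
  let S : (Fin n → ℂ) → (Fin n → ℂ) →ₗ[ℂ] (Fin n → ℂ) := fun y =>
    LinearMap.pi fun l => (1 - (‖y l‖ : ℂ) ^ 2) • LinearMap.proj l
  let T : (Fin n → ℂ) → (Fin n → ℂ) →ₗ[ℂ] (Fin n → ℂ) := fun y =>
    LinearMap.pi fun l => (1 - (‖y l‖ : ℂ) ^ 2)⁻¹ • LinearMap.proj l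
  have hST : ∀ {y : Fin n → ℂ}, y ∈ polydisk n → ∀ u, S y (T y u) = u := fun hy u => by
    funext l; simp [S, T, hh hy l]
  have hTS : ∀ {y : Fin n → ℂ}, y ∈ polydisk n → ∀ u, T y (S y u) = u := fun hy u => by
    funext l; simp [S, T, hh hy l]
  have hfat : HasFDerivAt f (fderiv ℂ f z) z :=
    (hfd.differentiableAt (isOpen_polydisk.mem_nhds hz)).hasFDerivAt
  have hgat : HasFDerivAt g (fderiv ℂ g (f z)) (f z) :=
    (hgd.differentiableAt (isOpen_polydisk.mem_nhds hfz)).hasFDerivAt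
  have hgf : ∀ u, fderiv ℂ g (f z) (fderiv ℂ f z u) = u := by
    have h1 : HasFDerivAt (g ∘ f) (ContinuousLinearMap.id ℂ _) z :=
      (hasFDerivAt_id z).congr_of_eventuallyEq (by
        filter_upwards [isOpen_polydisk.mem_nhds hz] with y hy using hinv.1 hy)
    intro u
    exact DFunLike.congr_fun ((hgat.comp z hfat).unique h1) u
  have hfg : ∀ u, fderiv ℂ f z (fderiv ℂ g (f z) u) = u := by
    have h1 : HasFDerivAt (f ∘ g) (ContinuousLinearMap.id ℂ _) (f z) :=
      (hasFDerivAt_id (f z)).congr_of_eventuallyEq (by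
        filter_upwards [isOpen_polydisk.mem_nhds hfz] with y hy using hinv.2 hy)
    have hfat' : HasFDerivAt f (fderiv ℂ f z) (g (f z)) := by rwa [hinv.1 hz]
    intro u
    exact DFunLike.congr_fun ((hfat'.comp (f z) hgat).unique h1) u
  let A : (Fin n → ℂ) →ₗ[ℂ] (Fin n → ℂ) := T (f z) ∘ₗ (fderiv ℂ f z : _ →ₗ[ℂ] _) ∘ₗ S z
  let B : (Fin n → ℂ) →ₗ[ℂ] (Fin n → ℂ) := T z ∘ₗ (fderiv ℂ g (f z) : _ →ₗ[ℂ] _) ∘ₗ S (f z)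
  obtain ⟨σ, hσ⟩ : ∃ σ : Equiv.Perm (Fin n), ∀ v i, ‖A v i‖ = ‖v (σ i)‖ := by
    refine exists_perm_of_norm_le (B := B) (fun u => ?_) (fun u => ?_) (fun u => ?_) (fun u => ?_)
    · refine (le_of_eq ?_).trans (norm_fderiv_mul_le hfd hf hz u)
      congr 1
      funext l
      exact (div_eq_inv_mul _ _).symm
    · refine (le_of_eq ?_).trans (norm_fderiv_mul_le hgd hg hfz u)
      congr 1
      funext l
      rw [hinv.1 hz]
      exact (div_eq_inv_mul _ _).symm
    · simp only [A, B, LinearMap.comp_apply, ContinuousLinearMap.coe_coe, hST hz, hfg, hTS hfz]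
    · simp only [A, B, LinearMap.comp_apply, ContinuousLinearMap.coe_coe, hST hfz, hgf, hTS hz]
  have hnorm : ∀ {y : Fin n → ℂ}, y ∈ polydisk n → ∀ u l, hypSq y u l = ‖T y u l‖ ^ 2 := by
    intro y hy u l
    have : ‖(1 - (‖y l‖ : ℂ) ^ 2)‖ = 1 - ‖y l‖ ^ 2 := by
      rw [show (1 - (‖y l‖ : ℂ) ^ 2) = ((1 - ‖y l‖ ^ 2 : ℝ) : ℂ) by push_cast; rfl,
        Complex.norm_real, Real.norm_of_nonneg (one_sub_norm_sq_pos hy l).le]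
    simp only [T, hypSq, LinearMap.pi_apply, LinearMap.smul_apply, LinearMap.proj_apply,
      smul_eq_mul, norm_mul, norm_inv, this]
    rw [mul_pow, inv_pow, ← div_eq_inv_mul]
  have hkey : hypSq (f z) (fderiv ℂ f z v) = fun l => hypSq z v (σ l) := by
    funext l
    rw [hnorm hfz, hnorm hz, ← hσ]
    simp only [A, LinearMap.comp_apply, ContinuousLinearMap.coe_coe, hST hz]
  rw [polydiskMetric_eq_sqrt ht, polydiskMetric_eq_sqrt ht, hkey, profile_comp_perm]

end

section

variable {n : ℕ} {t : ℝ} {k : ℕ}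

/-! ### The supporting linear functionals of the norm `q ↦ √(profile t k (q²))` -/

lemma sum_pow_mul_le (hk : 2 ≤ k) {Q q : Fin n → ℝ} (hQ : ∀ l, 0 ≤ Q l) (hq : ∀ l, 0 ≤ q l) :
    ∑ l, Q l ^ (2 * k - 1) * q l ≤
      (∑ l, Q l ^ (2 * k)) ^ (1 - 1 / (2 * k : ℝ)) * (∑ l, q l ^ (2 * k)) ^ (1 / (2 * k : ℝ)) := by
  have hk' : (2 : ℝ) ≤ k := by exact_mod_cast hk
  have hk1 : (2 * k - 1 : ℝ) ≠ 0 := by linarith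
  have hp : (2 * k : ℝ) ≠ 0 := by linarith
  have hpq : Real.HolderConjugate (2 * k / (2 * k - 1) : ℝ) (2 * k) := by
    refine Real.holderConjugate_iff.2 ⟨?_, ?_⟩
    · rw [lt_div_iff₀ (by linarith)]; linarith
    · field_simp
      ring
  have h := Real.inner_le_Lp_mul_Lq_of_nonneg Finset.univ hpq
    (f := fun l => Q l ^ (2 * k - 1)) (g := q) (fun l _ => pow_nonneg (hQ l) _) (fun l _ => hq l)
  have h1 : ∀ l, (Q l ^ (2 * k - 1)) ^ (2 * k / (2 * k - 1) : ℝ) = Q l ^ (2 * k) := by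
    intro l
    rw [← Real.rpow_natCast, ← Real.rpow_mul (hQ l), ← Real.rpow_natCast]
    congr 1
    rw [Nat.cast_sub (by omega)]
    push_cast
    field_simp
  have h2 : ∀ l, q l ^ (2 * k : ℝ) = q l ^ (2 * k) := by
    intro l
    rw [← Real.rpow_natCast]
    push_cast
    rfl
  simp only [h1, h2] at h
  refine h.trans_eq ?_
  congr 2
  field_simp

/-- The left side is, up to the factor `√(profile t k (Q²))`, the differential at `Q` of the norm `q
↦ √(profile t k (q²))`, and it has dual norm at most one. Cauchy-Schwarz handles the `ℓ²` part,
Hölder the `ℓ^(2k)` part, and a final Cauchy-Schwarz with weights `1` and `t` joins them. -/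
lemma sum_profileGrad_mul_mul_le (ht : 0 ≤ t) (hk : 2 ≤ k) {Q q : Fin n → ℝ}
    (hQ : ∀ l, 0 ≤ Q l) (hQ0 : Q ≠ 0) (hq : ∀ l, 0 ≤ q l) :
    ∑ l, profileGrad t k (fun l => Q l ^ 2) l * Q l * q l ≤
      √(profile t k fun l => Q l ^ 2) * √(profile t k fun l => q l ^ 2) := by
  have hS : 0 < ∑ l, Q l ^ (2 * k) := sum_pow_pos hQ hQ0 (2 * k)
  have hT : 0 ≤ ∑ l, q l ^ (2 * k) := Finset.sum_nonneg fun l _ => pow_nonneg (hq l) _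
  have hk0 : (k : ℝ) ≠ 0 := by positivity
  have hleft : ∑ l, profileGrad t k (fun l => Q l ^ 2) l * Q l * q l =
      (∑ l, Q l * q l + t * ((∑ l, Q l ^ (2 * k)) ^ ((1 : ℝ) / k - 1) *
        ∑ l, Q l ^ (2 * k - 1) * q l)) / (1 + t) := by
    rw [Finset.mul_sum, Finset.mul_sum, ← Finset.sum_add_distrib, Finset.sum_div]
    refine Finset.sum_congr rfl fun l _ => ?_
    simp only [profileGrad, ← pow_mul]
    rw [show 2 * k - 1 = 2 * (k - 1) + 1 by omega, pow_succ]
    ring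
  set S := ∑ l, Q l ^ (2 * k) with hSdef
  set T := ∑ l, q l ^ (2 * k) with hTdef
  have hcs : ∑ l, Q l * q l ≤ √(∑ l, Q l ^ 2) * √(∑ l, q l ^ 2) := by
    rw [← Real.sqrt_mul (by positivity)]
    exact Real.le_sqrt_of_sq_le (Finset.sum_mul_sq_le_sq_mul_sq _ _ _)
  have hhalf : ∀ {x : ℝ}, 0 ≤ x → x ^ (1 / (2 * k : ℝ)) = √(x ^ ((1 : ℝ) / k)) := by
    intro x hx
    rw [Real.sqrt_eq_rpow, ← Real.rpow_mul hx]
    congr 1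
    field_simp
  have hho : S ^ ((1 : ℝ) / k - 1) * ∑ l, Q l ^ (2 * k - 1) * q l ≤
      √(S ^ ((1 : ℝ) / k)) * √(T ^ ((1 : ℝ) / k)) := by
    rw [← hhalf hS.le, ← hhalf hT]
    calc S ^ ((1 : ℝ) / k - 1) * ∑ l, Q l ^ (2 * k - 1) * q l
        ≤ S ^ ((1 : ℝ) / k - 1) * (S ^ (1 - 1 / (2 * k : ℝ)) * T ^ (1 / (2 * k : ℝ))) :=
          mul_le_mul_of_nonneg_left (sum_pow_mul_le hk hQ hq) (by positivity)
      _ = _ := by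
          rw [← mul_assoc, ← Real.rpow_add hS]
          congr 2
          field_simp
          ring
  have hprof : ∀ x : Fin n → ℝ, profile t k (fun l => x l ^ 2) =
      (∑ l, x l ^ 2 + t * (∑ l, x l ^ (2 * k)) ^ ((1 : ℝ) / k)) / (1 + t) := by
    intro x
    simp only [profile, ← pow_mul]
  have h1t : 0 < 1 + t := by linarith
  rw [hleft, hprof, hprof, ← hSdef, ← hTdef, Real.sqrt_div' _ h1t.le, Real.sqrt_div' _ h1t.le,
    div_mul_div_comm, Real.mul_self_sqrt h1t.le]
  gcongr
  have hA : 0 ≤ ∑ l, Q l ^ 2 := by positivity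
  have hB : 0 ≤ ∑ l, q l ^ 2 := by positivity
  have hN : 0 ≤ S ^ ((1 : ℝ) / k) := by positivity
  have hM : 0 ≤ T ^ ((1 : ℝ) / k) := by positivity
  generalize ∑ l, Q l ^ 2 = A at *
  generalize ∑ l, q l ^ 2 = B at *
  generalize S ^ ((1 : ℝ) / k) = N at *
  generalize T ^ ((1 : ℝ) / k) = M at *
  calc _ ≤ √A * √B + t * (√N * √M) := add_le_add hcs (mul_le_mul_of_nonneg_left hho ht)
    _ ≤ √((A + t * N) * (B + t * M)) := by
      refine Real.le_sqrt_of_sq_le ?_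
      have e1 := Real.sq_sqrt hA
      have e2 := Real.sq_sqrt hB
      have e3 := Real.sq_sqrt hN
      have e4 := Real.sq_sqrt hM
      generalize √A = x1 at *
      generalize √B = x2 at *
      generalize √N = x3 at *
      generalize √M = x4 at *
      subst e1 e2 e3 e4
      nlinarith [mul_nonneg ht (sq_nonneg (x1 * x4 - x2 * x3))]
    _ = _ := Real.sqrt_mul (by positivity) _

/-! ### The Poincaré distance of the unit disk -/

/-- Twice the distance of the Poincaré metric `|dz|² / (1 - |z|²)²` of the unit disk. -/
noncomputable def poincareDist (p q : ℂ) : ℝ :=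
  Real.log ((1 + ‖(q - p) / (1 - conj p * q)‖) / (1 - ‖(q - p) / (1 - conj p * q)‖))

lemma mobius_neg (p q : ℂ) : mobius (-p) q = (q - p) / (1 - conj p * q) := by
  rw [mobius, map_neg, neg_mul, ← sub_eq_add_neg, ← sub_eq_add_neg]

lemma poincareDist_eq (p q : ℂ) :
    poincareDist p q = Real.log ((1 + ‖mobius (-p) q‖) / (1 - ‖mobius (-p) q‖)) := by
  rw [poincareDist, mobius_neg]

lemma norm_mobius_neg_lt_one {p q : ℂ} (hp : ‖p‖ < 1) (hq : ‖q‖ < 1) : ‖mobius (-p) q‖ < 1 :=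
  norm_mobius_lt_one (by rwa [norm_neg]) hq

lemma exp_poincareDist {p q : ℂ} (hp : ‖p‖ < 1) (hq : ‖q‖ < 1) :
    Real.exp (poincareDist p q) = (1 + ‖mobius (-p) q‖) / (1 - ‖mobius (-p) q‖) := by
  have h := norm_mobius_neg_lt_one hp hq
  rw [poincareDist_eq, Real.exp_log (div_pos (by positivity) (by linarith))]

lemma norm_mobius_le_poincareDist {p q : ℂ} (hp : ‖p‖ < 1) (hq : ‖q‖ < 1) :
    ‖mobius (-p) q‖ ≤ poincareDist p q := by
  have h := norm_mobius_neg_lt_one hp hq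
  have h0 := norm_nonneg (mobius (-p) q)
  rw [poincareDist_eq]
  -- With `r` the norm and `x = (1 + r) / (1 - r)`, one has `1 - 1/x = 2r / (1 + r) ≥ r`.
  refine le_trans ?_ (Real.one_sub_inv_le_log_of_pos (div_pos (by positivity) (by linarith)))
  rw [inv_div, one_sub_div (by positivity), le_div_iff₀ (by positivity)]
  nlinarith

lemma poincareDist_nonneg {p q : ℂ} (hp : ‖p‖ < 1) (hq : ‖q‖ < 1) : 0 ≤ poincareDist p q :=
  (norm_nonneg _).trans (norm_mobius_le_poincareDist hp hq)

/-- Möbius maps are isometries of the Poincaré metric. -/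
lemma norm_mobius_deriv_div {p z : ℂ} (hp : ‖p‖ < 1) (hz : ‖z‖ < 1) :
    ‖(1 - ‖p‖ ^ 2 : ℂ) / (1 + conj p * z) ^ 2‖ / (1 - ‖mobius p z‖ ^ 2) = 1 / (1 - ‖z‖ ^ 2) := by
  have h := norm_ne_zero_iff.2 (mobius_denom_ne_zero hp hz)
  have h2 : 0 < 1 - ‖p‖ ^ 2 := by nlinarith [norm_nonneg p]
  have h3 : 0 < 1 - ‖z‖ ^ 2 := by nlinarith [norm_nonneg z]
  have h4 : ‖(1 - ‖p‖ ^ 2 : ℂ)‖ = 1 - ‖p‖ ^ 2 := by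
    rw [show (1 - (‖p‖ : ℂ) ^ 2) = ((1 - ‖p‖ ^ 2 : ℝ) : ℂ) by push_cast; rfl,
      Complex.norm_real, Real.norm_of_nonneg h2.le]
  rw [one_sub_norm_sq_mobius hp hz, norm_div, norm_pow, h4]
  generalize ‖1 + conj p * z‖ = x at *
  field_simp

/-- A Möbius map moves the start to `0`, a rotation puts the end on the positive real axis, and
projection to that axis does not increase length. Projecting, rather than taking moduli, keeps the
function differentiable at `0`. -/
lemma poincareDist_le_integral {c c' : ℝ → ℂ}
    (hc : ∀ s ∈ Set.Icc (0 : ℝ) 1, HasDerivWithinAt c (c' s) (Set.Icc 0 1) s)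
    (hc' : ContinuousOn c' (Set.Icc 0 1)) (hlt : ∀ s ∈ Set.Icc (0 : ℝ) 1, ‖c s‖ < 1) :
    poincareDist (c 0) (c 1) / 2 ≤ ∫ s in (0 : ℝ)..1, ‖c' s‖ / (1 - ‖c s‖ ^ 2) := by
  have h0 : (0 : ℝ) ∈ Set.Icc (0 : ℝ) 1 := by simp
  have h1 : (1 : ℝ) ∈ Set.Icc (0 : ℝ) 1 := by simp
  have hp : ‖-c 0‖ < 1 := by simpa using hlt 0 h0
  have hcc : ContinuousOn c (Set.Icc 0 1) := fun s hs => (hc s hs).continuousWithinAt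
  -- When the endpoints agree the quotient defining `u` is `0`, hence only `‖u‖ ≤ 1` is claimed.
  obtain ⟨u, hu, hum⟩ : ∃ u : ℂ, ‖u‖ ≤ 1 ∧
      u * mobius (-c 0) (c 1) = ‖mobius (-c 0) (c 1)‖ := by
    refine ⟨conj (mobius (-c 0) (c 1)) / ‖mobius (-c 0) (c 1)‖, ?_, ?_⟩
    · simp only [norm_div, RCLike.norm_conj, Complex.norm_real, norm_norm]
      exact div_self_le_one _
    · by_cases h : mobius (-c 0) (c 1) = 0
      · simp [h]
      · have : (‖mobius (-c 0) (c 1)‖ : ℂ) ≠ 0 := by simpa using h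
        rw [div_mul_eq_mul_div, Complex.conj_mul', sq, mul_div_assoc, div_self this, mul_one]
  set x : ℝ → ℝ := fun s => (u * mobius (-c 0) (c s)).re with hx
  set D : ℝ → ℂ := fun s => (1 - ‖-c 0‖ ^ 2 : ℂ) / (1 + conj (-c 0) * c s) ^ 2 with hD
  have hxd : ∀ s ∈ Set.Icc (0 : ℝ) 1,
      HasDerivWithinAt x (u * (D s * c' s)).re (Set.Icc 0 1) s := by
    intro s hs
    have h := (hasDerivAt_mobius hp (hlt s hs)).comp_hasDerivWithinAt s (hc s hs)
    exact Complex.reCLM.hasFDerivAt.comp_hasDerivWithinAt s (h.const_mul u)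
  have hxle : ∀ s ∈ Set.Icc (0 : ℝ) 1, |x s| ≤ ‖mobius (-c 0) (c s)‖ := by
    intro s _
    refine (Complex.abs_re_le_norm _).trans ?_
    rw [norm_mul]
    exact mul_le_of_le_one_left (norm_nonneg _) hu
  have hxlt : ∀ s ∈ Set.Icc (0 : ℝ) 1, |x s| < 1 := fun s hs =>
    (hxle s hs).trans_lt (norm_mobius_lt_one hp (hlt s hs))
  -- `y = artanh x`, the Poincaré arc length along the real diameter.
  set y : ℝ → ℝ := fun s => (Real.log (1 + x s) - Real.log (1 - x s)) / 2 with hy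
  have hyd : ∀ s ∈ Set.Icc (0 : ℝ) 1,
      HasDerivWithinAt y ((u * (D s * c' s)).re / (1 - x s ^ 2)) (Set.Icc 0 1) s := by
    intro s hs
    have ha := abs_lt.1 (hxlt s hs)
    have hp1 : 1 + x s ≠ 0 := by linarith
    have hp2 : 1 - x s ≠ 0 := by linarith
    have hp3 : 1 - x s ^ 2 ≠ 0 := by
      rw [show 1 - x s ^ 2 = (1 + x s) * (1 - x s) by ring]
      exact mul_ne_zero hp1 hp2
    refine ((((hxd s hs).const_add 1).log hp1).sub
      (((hxd s hs).const_sub 1).log hp2)).div_const 2 |>.congr_deriv ?_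
    field_simp
    ring
  have hφ : ContinuousOn (fun s => ‖c' s‖ / (1 - ‖c s‖ ^ 2)) (Set.Icc 0 1) := by
    refine hc'.norm.div (continuousOn_const.sub (hcc.norm.pow 2)) fun s hs => ?_
    nlinarith [norm_nonneg (c s), hlt s hs]
  have hmain := intervalIntegral.sub_le_integral_of_hasDeriv_right_of_le (zero_le_one' ℝ)
    (g := y) (fun s hs => (hyd s hs).continuousWithinAt)
    (fun s hs => ((hyd s (Set.Ioo_subset_Icc_self hs)).hasDerivAt
      (Icc_mem_nhds hs.1 hs.2)).hasDerivWithinAt)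
    hφ.integrableOn_Icc (fun s hs' => by
      have hs := Set.Ioo_subset_Icc_self hs'
      have hm := norm_mobius_lt_one hp (hlt s hs)
      have hm2 : 0 < 1 - ‖mobius (-c 0) (c s)‖ ^ 2 := by
        nlinarith [norm_nonneg (mobius (-c 0) (c s))]
      have hsq : x s ^ 2 ≤ ‖mobius (-c 0) (c s)‖ ^ 2 := by
        rw [← sq_abs]
        exact pow_le_pow_left₀ (abs_nonneg _) (hxle s hs) 2
      have hnum : (u * (D s * c' s)).re ≤ ‖D s‖ * ‖c' s‖ := by
        refine (Complex.re_le_norm _).trans ?_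
        rw [norm_mul, norm_mul]
        exact mul_le_of_le_one_left (by positivity) hu
      calc (u * (D s * c' s)).re / (1 - x s ^ 2)
          ≤ ‖D s‖ * ‖c' s‖ / (1 - ‖mobius (-c 0) (c s)‖ ^ 2) :=
            div_le_div₀ (by positivity) hnum hm2 (by linarith)
        _ = ‖D s‖ / (1 - ‖mobius (-c 0) (c s)‖ ^ 2) * ‖c' s‖ := by ring
        _ = ‖c' s‖ / (1 - ‖c s‖ ^ 2) := by
          rw [hD, norm_mobius_deriv_div hp (hlt s hs)]
          ring)
  refine le_trans (le_of_eq ?_) hmain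
  have hx0 : x 0 = 0 := by simp [hx, mobius]
  have hx1 : x 1 = ‖mobius (-c 0) (c 1)‖ := by simp only [hx, hum, Complex.ofReal_re]
  have hlt1 := norm_mobius_lt_one hp (hlt 1 h1)
  simp only [hy, hx0, hx1]
  rw [poincareDist_eq, Real.log_div (by positivity) (by linarith)]
  simp

end

section

variable {n : ℕ} {t : ℝ} {k : ℕ}

/-! ### The distance of the metrics `F_{t,k}` -/

lemma profile_zero (t : ℝ) (hk : 2 ≤ k) : profile t k (fun _ : Fin n => (0 : ℝ)) = 0 := by
  have := profile_smul (t := t) (c := 0) le_rfl hk (a := fun _ : Fin n => (0 : ℝ))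
    fun _ => le_rfl
  simpa using this

/-- The values of the distance of `F_{t,k}`. -/
noncomputable def polydiskDist (t : ℝ) (k : ℕ) (p q : Fin n → ℂ) : ℝ :=
  √(profile t k fun l => (poincareDist (p l) (q l) / 2) ^ 2)

lemma polydiskDist_eq (ht : 0 ≤ t) (hk : 2 ≤ k) (p q : Fin n → ℂ) :
    polydiskDist t k p q = 1 / (2 * √(1 + t)) * √(∑ l, poincareDist (p l) (q l) ^ 2 +
      t * (∑ l, poincareDist (p l) (q l) ^ (2 * k)) ^ ((1 : ℝ) / k)) := by
  have h : (fun l => (poincareDist (p l) (q l) / 2) ^ 2) =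
      fun l => (1 / 2 : ℝ) ^ 2 * poincareDist (p l) (q l) ^ 2 := by
    funext l; ring
  rw [polydiskDist, h, profile_smul (by positivity) hk fun l => sq_nonneg _,
    Real.sqrt_mul (by positivity), Real.sqrt_sq (by positivity)]
  simp only [profile, ← pow_mul]
  rw [Real.sqrt_div' _ (by linarith)]
  field_simp

/-- The norm of an integral is at most the integral of the norm: the supporting functional at `Q`
has nonnegative coefficients and is integrated against `q`. The case `Q = 0`, where it is
unavailable, is trivial. -/
lemma sqrt_profile_le_integral (ht : 0 ≤ t) (hk : 2 ≤ k) {Q : Fin n → ℝ} {q : ℝ → Fin n → ℝ}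
    (hQ : ∀ l, 0 ≤ Q l) (hq : ∀ s ∈ Set.Icc (0 : ℝ) 1, ∀ l, 0 ≤ q s l)
    (hcont : ContinuousOn q (Set.Icc 0 1)) (hle : ∀ l, Q l ≤ ∫ s in (0 : ℝ)..1, q s l) :
    √(profile t k fun l => Q l ^ 2) ≤ ∫ s in (0 : ℝ)..1, √(profile t k fun l => q s l ^ 2) := by
  by_cases hQ0 : Q = 0
  · have h0 : (fun l => Q l ^ 2) = fun _ => (0 : ℝ) := by funext l; simp [hQ0]
    rw [h0, profile_zero t hk, Real.sqrt_zero]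
    exact intervalIntegral.integral_nonneg zero_le_one fun s _ => Real.sqrt_nonneg _
  have hS : 0 < ∑ l, (Q l ^ 2) ^ k := by
    simpa only [← pow_mul] using sum_pow_pos hQ hQ0 (2 * k)
  have hQsq : (fun l => Q l ^ 2) ≠ 0 := fun h => hQ0 (funext fun l => by
    simpa using congrFun h l)
  have hpos : 0 < profile t k fun l => Q l ^ 2 := profile_pos ht hk (fun l => sq_nonneg _) hQsq
  have hg : ∀ l, 0 ≤ profileGrad t k (fun l => Q l ^ 2) l * Q l := fun l =>
    mul_nonneg (profileGrad_pos ht k (fun l => sq_nonneg _) l).le (hQ l)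
  have hcq : ∀ l, ContinuousOn (fun s => q s l) (Set.Icc 0 1) := continuousOn_pi.1 hcont
  have hint : ∀ l, IntervalIntegrable (fun s => q s l) MeasureTheory.volume 0 1 := fun l =>
    ContinuousOn.intervalIntegrable (by rw [Set.uIcc_of_le zero_le_one]; exact hcq l)
  have hF : ContinuousOn (fun s => √(profile t k fun l => q s l ^ 2)) (Set.Icc 0 1) :=
    ((continuous_profile t k).comp_continuousOn (continuousOn_pi.2 fun l => (hcq l).pow 2)).sqrt
  have hFint : IntervalIntegrable (fun s => √(profile t k fun l => q s l ^ 2))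
      MeasureTheory.volume 0 1 :=
    ContinuousOn.intervalIntegrable (by rw [Set.uIcc_of_le zero_le_one]; exact hF)
  refine le_of_mul_le_mul_left (a := √(profile t k fun l => Q l ^ 2)) ?_ (Real.sqrt_pos.2 hpos)
  calc √(profile t k fun l => Q l ^ 2) * √(profile t k fun l => Q l ^ 2)
      = ∑ l, profileGrad t k (fun l => Q l ^ 2) l * Q l * Q l := by
        rw [Real.mul_self_sqrt hpos.le, ← sum_profileGrad_mul t hk hS]
        exact Finset.sum_congr rfl fun l _ => by ring
    _ ≤ ∑ l, profileGrad t k (fun l => Q l ^ 2) l * Q l * ∫ s in (0 : ℝ)..1, q s l :=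
        Finset.sum_le_sum fun l _ => mul_le_mul_of_nonneg_left (hle l) (hg l)
    _ = ∫ s in (0 : ℝ)..1, ∑ l, profileGrad t k (fun l => Q l ^ 2) l * Q l * q s l := by
        rw [intervalIntegral.integral_finsetSum fun l _ => (hint l).const_mul _]
        simp only [intervalIntegral.integral_const_mul]
    _ ≤ ∫ s in (0 : ℝ)..1, √(profile t k fun l => Q l ^ 2) *
          √(profile t k fun l => q s l ^ 2) := by
        refine intervalIntegral.integral_mono_on zero_le_one ?_ (hFint.const_mul _) fun s hs =>
          sum_profileGrad_mul_mul_le ht hk hQ hQ0 (hq s hs)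
        refine ContinuousOn.intervalIntegrable ?_
        rw [Set.uIcc_of_le zero_le_one]
        exact continuousOn_finsetSum _ fun l _ => continuousOn_const.mul (hcq l)
    _ = _ := intervalIntegral.integral_const_mul _ _

lemma polydiskDist_le_curveLength (ht : 0 ≤ t) (hk : 2 ≤ k) {p q : Fin n → ℂ}
    {γ : ℝ → Fin n → ℂ} (hγ : IsCurve (polydisk n) p q γ) :
    polydiskDist t k p q ≤ curveLength (polydiskMetric n t k) γ := by
  obtain ⟨hC, hmaps, rfl, rfl⟩ := hγ
  have h0 : γ 0 ∈ polydisk n := hmaps (by simp)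
  have h1 : γ 1 ∈ polydisk n := hmaps (by simp)
  have hd : ∀ s ∈ Set.Icc (0 : ℝ) 1,
      HasDerivWithinAt γ (derivWithin γ (Set.Icc 0 1) s) (Set.Icc 0 1) s := fun s hs =>
    (hC.differentiableOn one_ne_zero s hs).hasDerivWithinAt
  have hc' : ContinuousOn (derivWithin γ (Set.Icc 0 1)) (Set.Icc 0 1) :=
    hC.continuousOn_derivWithin (uniqueDiffOn_Icc one_pos) le_rfl
  have hlen : curveLength (polydiskMetric n t k) γ = ∫ s in (0 : ℝ)..1, √(profile t k fun l =>
      (‖derivWithin γ (Set.Icc 0 1) s l‖ / (1 - ‖γ s l‖ ^ 2)) ^ 2) := by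
    simp only [curveLength, polydiskMetric_eq_sqrt ht, div_pow]
    rfl
  rw [hlen]
  refine sqrt_profile_le_integral ht hk (fun l => ?_)
    (fun s hs l => div_nonneg (norm_nonneg _) (one_sub_norm_sq_pos (hmaps hs) l).le) ?_ fun l => ?_
  · have := poincareDist_nonneg (h0 l) (h1 l)
    positivity
  · refine continuousOn_pi.2 fun l => (continuousOn_pi.1 hc' l).norm.div (continuousOn_const.sub
      ((continuousOn_pi.1 hC.continuousOn l).norm.pow 2)) fun s hs =>
      (one_sub_norm_sq_pos (hmaps hs) l).ne'
  · exact poincareDist_le_integral (c := fun s => γ s l)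
      (fun s hs => hasDerivWithinAt_pi.1 (hd s hs) l) (continuousOn_pi.1 hc' l)
      fun s hs => hmaps hs l

/-! ### The minimizing geodesics -/

lemma mobius_mobius_neg {p q : ℂ} (hp : ‖p‖ < 1) (hq : ‖q‖ < 1) :
    mobius p (mobius (-p) q) = q := by
  have h1 : 1 - conj p * q ≠ 0 := by
    have := mobius_denom_ne_zero (p := -p) (by rwa [norm_neg]) hq
    rwa [map_neg, neg_mul, ← sub_eq_add_neg] at this
  have h2 := mobius_denom_ne_zero hp (norm_mobius_neg_lt_one hp hq)
  rw [mobius, div_eq_iff h2, mobius_neg, div_add' _ _ _ h1, div_eq_iff h1, mul_assoc, add_mul,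
    mul_assoc, div_mul_cancel₀ _ h1]
  ring

lemma exp_sub_one_div_exp_add_one (x : ℝ) :
    1 - ((Real.exp x - 1) / (Real.exp x + 1)) ^ 2 = 4 * Real.exp x / (Real.exp x + 1) ^ 2 := by
  have := Real.exp_pos x
  field_simp
  ring

lemma abs_exp_sub_one_div_lt_one (x : ℝ) : |(Real.exp x - 1) / (Real.exp x + 1)| < 1 := by
  have := Real.exp_pos x
  rw [abs_lt, lt_div_iff₀ (by linarith), div_lt_one (by linarith)]
  constructor <;> linarith

/-- The function is `tanh (L s / 2)`, so it moves along the real diameter with constant Poincaré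
speed `L / 2`. -/
lemma hasDerivAt_exp_sub_one_div (L s : ℝ) :
    HasDerivAt (fun s => (Real.exp (L * s) - 1) / (Real.exp (L * s) + 1))
      (L / 2 * (1 - ((Real.exp (L * s) - 1) / (Real.exp (L * s) + 1)) ^ 2)) s := by
  have hpos := Real.exp_pos (L * s)
  have h := ((hasDerivAt_id s).const_mul L).exp
  refine ((h.sub_const 1).div (h.add_const 1) (by positivity)).congr_deriv ?_
  rw [exp_sub_one_div_exp_add_one]
  simp only [id]
  field_simp
  ring

/-- The geodesic of the unit disk from `p` to `q`, parametrized by `[0, 1]`. -/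
noncomputable def diskGeodesic (p q : ℂ) (s : ℝ) : ℂ :=
  mobius p (mobius (-p) q / ‖mobius (-p) q‖ *
    ((Real.exp (poincareDist p q * s) - 1) / (Real.exp (poincareDist p q * s) + 1) : ℝ))

lemma norm_div_norm_mul_lt_one (m : ℂ) {r : ℝ} (hr : |r| < 1) : ‖m / ‖m‖ * (r : ℂ)‖ < 1 := by
  rw [norm_mul, norm_div, Complex.norm_real, norm_norm, Complex.norm_real, Real.norm_eq_abs]
  exact lt_of_le_of_lt (mul_le_of_le_one_left (abs_nonneg _) (div_self_le_one _)) hr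

lemma diskGeodesic_zero (p q : ℂ) : diskGeodesic p q 0 = p := by
  simp [diskGeodesic, mobius]

lemma diskGeodesic_one {p q : ℂ} (hp : ‖p‖ < 1) (hq : ‖q‖ < 1) : diskGeodesic p q 1 = q := by
  have h := norm_mobius_neg_lt_one hp hq
  have h1 : (Real.exp (poincareDist p q * 1) - 1) / (Real.exp (poincareDist p q * 1) + 1) =
      ‖mobius (-p) q‖ := by
    rw [mul_one, exp_poincareDist hp hq]
    have : 1 - ‖mobius (-p) q‖ ≠ 0 := by linarith
    field_simp
    ring
  rw [diskGeodesic, h1]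
  conv_rhs => rw [← mobius_mobius_neg hp hq]
  congr 1
  by_cases h0 : mobius (-p) q = 0
  · simp [h0]
  · exact div_mul_cancel₀ _ (by simpa using h0)

lemma norm_diskGeodesic_lt_one {p : ℂ} (hp : ‖p‖ < 1) (q : ℂ) (s : ℝ) :
    ‖diskGeodesic p q s‖ < 1 :=
  norm_mobius_lt_one hp (norm_div_norm_mul_lt_one _ (abs_exp_sub_one_div_lt_one _))

lemma contDiff_diskGeodesic {p : ℂ} (hp : ‖p‖ < 1) (q : ℂ) :
    ContDiff ℝ 1 (diskGeodesic p q) := by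
  have h1 : ContDiff ℝ 1 fun s : ℝ =>
      (Real.exp (poincareDist p q * s) - 1) / (Real.exp (poincareDist p q * s) + 1) :=
    ContDiff.div (by fun_prop) (by fun_prop) fun s => by positivity
  have h2 : ContDiff ℝ 1 fun s : ℝ => mobius (-p) q / ‖mobius (-p) q‖ *
      (((Real.exp (poincareDist p q * s) - 1) / (Real.exp (poincareDist p q * s) + 1) : ℝ) : ℂ) :=
    contDiff_const.mul (Complex.ofRealCLM.contDiff.comp h1)
  have h3 : ContDiff ℝ 1 fun s : ℝ => 1 + conj p * (mobius (-p) q / ‖mobius (-p) q‖ *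
      (((Real.exp (poincareDist p q * s) - 1) / (Real.exp (poincareDist p q * s) + 1) : ℝ) : ℂ)) :=
    contDiff_const.add (contDiff_const.mul h2)
  have h4 := (h2.add (contDiff_const (c := p))).mul (h3.inv fun s =>
    mobius_denom_ne_zero hp (norm_div_norm_mul_lt_one _ (abs_exp_sub_one_div_lt_one _)))
  convert! h4 using 1

lemma exists_hasDerivAt_diskGeodesic {p q : ℂ} (hp : ‖p‖ < 1) (hq : ‖q‖ < 1) (s : ℝ) :
    ∃ v, HasDerivAt (diskGeodesic p q) v s ∧
      ‖v‖ / (1 - ‖diskGeodesic p q s‖ ^ 2) = poincareDist p q / 2 := by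
  set L := poincareDist p q with hL
  have hL0 : 0 ≤ L := poincareDist_nonneg hp hq
  set m := mobius (-p) q with hm
  set r := (Real.exp (L * s) - 1) / (Real.exp (L * s) + 1) with hr
  have hrlt : |r| < 1 := abs_exp_sub_one_div_lt_one _
  have hlt := norm_div_norm_mul_lt_one m hrlt
  have hd1 : HasDerivAt (fun s : ℝ => m / ‖m‖ *
      (((Real.exp (L * s) - 1) / (Real.exp (L * s) + 1) : ℝ) : ℂ))
      (m / ‖m‖ * ((L / 2 * (1 - r ^ 2) : ℝ) : ℂ)) s :=
    (hasDerivAt_exp_sub_one_div L s).ofReal_comp.const_mul _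
  have hd2 := (hasDerivAt_mobius hp hlt).comp s hd1
  refine ⟨_, hd2, ?_⟩
  have hr2 : 0 < 1 - r ^ 2 := by
    rw [← sq_abs]; nlinarith [abs_nonneg r]
  rw [norm_mul, mul_div_right_comm]
  change _ / (1 - ‖mobius p (m / ‖m‖ * (r : ℂ))‖ ^ 2) * _ = _
  rw [norm_mobius_deriv_div hp hlt]
  simp only [norm_mul, norm_div, Complex.norm_real, Real.norm_eq_abs,
    abs_norm, abs_of_pos hr2, abs_of_nonneg hL0, Nat.abs_ofNat, mul_pow, sq_abs]
  -- If `m = 0` the geodesic is constant, and both sides are `0` since `m / ‖m‖` is then `0`.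
  by_cases h0 : m = 0
  · have : L = 0 := by rw [hL, poincareDist_eq, ← hm, h0]; simp
    rw [this]; simp
  · rw [div_self (norm_ne_zero_iff.2 h0)]
    field_simp

/-- All components of the product of disk geodesics have constant Poincaré speed on `[0, 1]`, so the
integrand is constant and equals the claimed distance. -/
lemma exists_curveLength_eq (ht : 0 ≤ t) (k : ℕ) {p q : Fin n → ℂ} (hp : p ∈ polydisk n)
    (hq : q ∈ polydisk n) : ∃ γ, IsCurve (polydisk n) p q γ ∧
      curveLength (polydiskMetric n t k) γ = polydiskDist t k p q := by
  refine ⟨fun s l => diskGeodesic (p l) (q l) s,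
    ⟨(contDiff_pi.2 fun l => contDiff_diskGeodesic (hp l) (q l)).contDiffOn,
      fun s _ l => norm_diskGeodesic_lt_one (hp l) (q l) s,
      funext fun l => diskGeodesic_zero _ _, funext fun l => diskGeodesic_one (hp l) (hq l)⟩, ?_⟩
  choose v hv hvn using fun (l : Fin n) (s : ℝ) =>
    exists_hasDerivAt_diskGeodesic (hp l) (hq l) s
  have hderiv : ∀ s ∈ Set.Icc (0 : ℝ) 1,
      derivWithin (fun s l => diskGeodesic (p l) (q l) s) (Set.Icc 0 1) s = fun l => v l s :=
    fun s hs => ((hasDerivAt_pi.2 fun l => hv l s).hasDerivWithinAt).derivWithin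
      (uniqueDiffOn_Icc one_pos s hs)
  have hF : ∀ s ∈ Set.uIcc (0 : ℝ) 1, polydiskMetric n t k (fun l => diskGeodesic (p l) (q l) s)
      (derivWithin (fun s l => diskGeodesic (p l) (q l) s) (Set.Icc 0 1) s) =
      polydiskDist t k p q := by
    intro s hs
    rw [Set.uIcc_of_le zero_le_one] at hs
    rw [hderiv s hs, polydiskMetric_eq_sqrt ht, polydiskDist]
    congr 2
    funext l
    rw [hypSq, ← div_pow, hvn]
  rw [curveLength, intervalIntegral.integral_congr hF]
  simp

theorem finslerDist_polydiskMetric (ht : 0 ≤ t) (hk : 2 ≤ k) {p q : Fin n → ℂ}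
    (hp : p ∈ polydisk n) (hq : q ∈ polydisk n) :
    finslerDist (polydisk n) (polydiskMetric n t k) p q = polydiskDist t k p q := by
  refine IsLeast.csInf_eq ⟨exists_curveLength_eq ht k hp hq, ?_⟩
  rintro _ ⟨γ, hγ, rfl⟩
  exact polydiskDist_le_curveLength ht hk hγ

/-! ### Completeness -/

lemma poincareDist_le_polydiskDist (ht : 0 ≤ t) (hk : 2 ≤ k) {p q : Fin n → ℂ}
    (hp : p ∈ polydisk n) (hq : q ∈ polydisk n) (l : Fin n) :
    poincareDist (p l) (q l) ≤ 2 * polydiskDist t k p q := by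
  have h1 := le_profile ht hk (a := fun l => (poincareDist (p l) (q l) / 2) ^ 2)
    (fun l => sq_nonneg _) l
  have h2 := Real.sqrt_le_sqrt h1
  have h3 := poincareDist_nonneg (hp l) (hq l)
  rw [Real.sqrt_sq (by positivity)] at h2
  rw [polydiskDist]
  linarith

lemma norm_sub_le_poincareDist {p q : ℂ} (hp : ‖p‖ < 1) (hq : ‖q‖ < 1) :
    ‖p - q‖ ≤ 2 * poincareDist p q := by
  have hne : 1 - conj p * q ≠ 0 := by
    have := mobius_denom_ne_zero (p := -p) (by rwa [norm_neg]) hq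
    rwa [map_neg, neg_mul, ← sub_eq_add_neg] at this
  have h1 := norm_mobius_le_poincareDist hp hq
  have h2 : ‖1 - conj p * q‖ ≤ 2 := by
    refine (norm_sub_le _ _).trans ?_
    rw [norm_one, norm_mul, RCLike.norm_conj]
    nlinarith [norm_nonneg p, norm_nonneg q]
  have h3 : q - p = mobius (-p) q * (1 - conj p * q) := by
    rw [mobius_neg, div_mul_cancel₀ _ hne]
  rw [norm_sub_rev, h3, norm_mul]
  nlinarith [norm_nonneg (mobius (-p) q)]

/-- The constant is `tanh (1/2)`, the pseudohyperbolic radius that corresponds to `poincareDist =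
1`. The inequality is free of denominators in `q`, so it passes to limits in the closed disk. -/
lemma norm_sub_le_of_poincareDist_lt_one {p q : ℂ} (hp : ‖p‖ < 1) (hq : ‖q‖ < 1)
    (h : poincareDist p q < 1) :
    ‖q - p‖ ≤ (Real.exp 1 - 1) / (Real.exp 1 + 1) * ‖1 - conj p * q‖ := by
  have hne : 1 - conj p * q ≠ 0 := by
    have := mobius_denom_ne_zero (p := -p) (by rwa [norm_neg]) hq
    rwa [map_neg, neg_mul, ← sub_eq_add_neg] at this
  have h1 := norm_mobius_neg_lt_one hp hq
  have h2 := Real.exp_lt_exp.2 h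
  rw [exp_poincareDist hp hq, div_lt_iff₀ (by linarith)] at h2
  have h3 : q - p = mobius (-p) q * (1 - conj p * q) := by
    rw [mobius_neg, div_mul_cancel₀ _ hne]
  rw [h3, norm_mul]
  gcongr
  rw [le_div_iff₀ (by positivity)]
  linarith

/-- If `‖q‖ ≥ 1`, then `|1 - p̄q|² - |q - p|² = (1 - |p|²)(1 - |q|²) ≤ 0`; with `r < 1` this forces
`1 - p̄q = 0`, hence `q = p`, a contradiction. -/
lemma norm_lt_one_of_norm_sub_le {p q : ℂ} {r : ℝ} (hp : ‖p‖ < 1) (hr0 : 0 ≤ r) (hr : r < 1)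
    (h : ‖q - p‖ ≤ r * ‖1 - conj p * q‖) : ‖q‖ < 1 := by
  by_contra! hq
  have h1 := norm_sq_mobius_denom_sub (-p) q
  rw [map_neg, neg_mul, ← sub_eq_add_neg, ← sub_eq_add_neg, norm_neg] at h1
  have h2 : (1 - ‖p‖ ^ 2) * (1 - ‖q‖ ^ 2) ≤ 0 :=
    mul_nonpos_of_nonneg_of_nonpos (by nlinarith [norm_nonneg p]) (by nlinarith)
  have h3 : ‖q - p‖ ^ 2 ≤ r ^ 2 * ‖1 - conj p * q‖ ^ 2 := by
    rw [← mul_pow]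
    exact pow_le_pow_left₀ (norm_nonneg _) h 2
  have h4 : r ^ 2 < 1 := by nlinarith
  have h5 : ‖1 - conj p * q‖ ^ 2 ≤ 0 := by
    by_contra! hpos
    nlinarith
  have h6 : ‖q - p‖ ≤ 0 := by
    have : ‖1 - conj p * q‖ = 0 := pow_eq_zero_iff two_ne_zero |>.1 (le_antisymm h5 (sq_nonneg _))
    rwa [this, mul_zero] at h
  have h7 : q = p := sub_eq_zero.1 (norm_le_zero_iff.1 h6)
  rw [h7] at hq
  linarith

lemma continuousAt_poincareDist {p : ℂ} (hp : ‖p‖ < 1) :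
    ContinuousAt (fun z => poincareDist z p) p := by
  have hne : 1 - conj p * p ≠ 0 := by
    have := mobius_denom_ne_zero (p := -p) (by rwa [norm_neg]) hp
    rwa [map_neg, neg_mul, ← sub_eq_add_neg] at this
  have h1 : ContinuousAt (fun z : ℂ => ‖(p - z) / (1 - conj z * p)‖) p := by
    refine ContinuousAt.norm (ContinuousAt.div (by fun_prop) ?_ hne)
    exact continuousAt_const.sub (Complex.continuous_conj.continuousAt.mul continuousAt_const)
  refine ContinuousAt.log (ContinuousAt.div (continuousAt_const.add h1)
    (continuousAt_const.sub h1) ?_) ?_ <;> simp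

theorem isFinslerComplete_polydiskMetric (ht : 0 ≤ t) (hk : 2 ≤ k) :
    IsFinslerComplete (polydisk n) (polydiskMetric n t k) := by
  intro u hu hcauchy
  have hdist : ∀ ε > 0, ∃ N, ∀ i ≥ N, ∀ j ≥ N, ∀ l, poincareDist (u i l) (u j l) < ε := by
    intro ε hε
    obtain ⟨N, hN⟩ := hcauchy (ε / 2) (by positivity)
    refine ⟨N, fun i hi j hj l => ?_⟩
    have h1 := hN i hi j hj
    rw [finslerDist_polydiskMetric ht hk (hu i) (hu j)] at h1
    have := poincareDist_le_polydiskDist ht hk (hu i) (hu j) l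
    linarith
  have hcs : CauchySeq u := by
    refine Metric.cauchySeq_iff.2 fun ε hε => ?_
    obtain ⟨N, hN⟩ := hdist (ε / 2) (by positivity)
    refine ⟨N, fun i hi j hj => (dist_pi_lt_iff hε).2 fun l => ?_⟩
    have h1 := hN i hi j hj l
    have h2 := norm_sub_le_poincareDist (hu i l) (hu j l)
    rw [dist_eq_norm]
    linarith
  obtain ⟨p, hp⟩ := cauchySeq_tendsto_of_complete hcs
  have hpl : ∀ l, Filter.Tendsto (fun i => u i l) Filter.atTop (nhds (p l)) :=
    tendsto_pi_nhds.1 hp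
  -- The Euclidean limit could lie on the boundary. The tail of the sequence stays within
  -- `poincareDist` less than `1` of `u N` in each component, and that closed estimate keeps the
  -- limit inside.
  have hpD : p ∈ polydisk n := by
    obtain ⟨N, hN⟩ := hdist 1 one_pos
    intro l
    have he : 1 < Real.exp 1 := Real.one_lt_exp_iff.2 one_pos
    refine norm_lt_one_of_norm_sub_le (hu N l)
      (r := (Real.exp 1 - 1) / (Real.exp 1 + 1))
      (div_nonneg (by linarith) (by linarith)) ((div_lt_one (by linarith)).2 (by linarith)) ?_
    refine le_of_tendsto_of_tendsto ((hpl l).sub_const _).norm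
      ((tendsto_const_nhds.sub ((hpl l).const_mul _)).norm.const_mul _) ?_
    filter_upwards [Filter.eventually_ge_atTop N] with i hi
    exact norm_sub_le_of_poincareDist_lt_one (hu N l) (hu i l) (hN N le_rfl i hi l)
  refine ⟨p, hpD, ?_⟩
  simp only [finslerDist_polydiskMetric ht hk (hu _) hpD]
  have hlim : Filter.Tendsto (fun i l => (poincareDist (u i l) (p l) / 2) ^ 2) Filter.atTop
      (nhds fun _ => 0) := by
    refine tendsto_pi_nhds.2 fun l => ?_
    have h1 := (continuousAt_poincareDist (hpD l)).tendsto.comp (hpl l)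
    have h0 : poincareDist (p l) (p l) = 0 := by simp [poincareDist]
    rw [h0] at h1
    simpa using (h1.div_const 2).pow 2
  have := (((continuous_profile t k).tendsto _).comp hlim).sqrt
  rwa [profile_zero t hk, Real.sqrt_zero] at this

end

end ComplexFinsler

/-! ### The theorem. -/

theorem mainTheorem5 (n : ℕ) (hn : 2 ≤ n) (t : ℝ) (ht : 0 ≤ t) (k : ℕ) (hk : 2 ≤ k) :
    (ComplexFinsler.IsAutInvariant (ComplexFinsler.polydisk n)
        (ComplexFinsler.polydiskMetric n t k) ∧
      ComplexFinsler.IsFinslerComplete (ComplexFinsler.polydisk n)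
        (ComplexFinsler.polydiskMetric n t k) ∧
      ComplexFinsler.IsStronglyConvex (ComplexFinsler.polydisk n)
        (ComplexFinsler.polydiskMetric n t k) ∧
      ComplexFinsler.IsKahlerBerwald (ComplexFinsler.polydisk n)
        (ComplexFinsler.polydiskMetric n t k) ∧
      ∀ z ∈ ComplexFinsler.polydisk n, ∀ v : Fin n → ℂ, v ≠ 0 →
        ∃ K : ℝ, ComplexFinsler.holSectCurvature (ComplexFinsler.polydiskMetric n t k) z v = K ∧
          K ∈ Set.Icc (-4 : ℝ) (-(4 * (1 + t) / (n + t * (n : ℝ) ^ ((1 : ℝ) / k))))) ∧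
    ((∀ I : Set ℝ, I.OrdConnected → I.Nontrivial → ∀ γ : ℝ → (Fin n → ℂ),
        (ComplexFinsler.IsGeodesicOn (ComplexFinsler.polydisk n)
            (ComplexFinsler.polydiskMetric n t k) I γ ↔
          ComplexFinsler.IsGeodesicOn (ComplexFinsler.polydisk n)
            (ComplexFinsler.bergmanMetric n) I γ)) ∧
      ∀ Z₁ ∈ ComplexFinsler.polydisk n, ∀ Z₂ ∈ ComplexFinsler.polydisk n,
        ComplexFinsler.finslerDist (ComplexFinsler.polydisk n)
            (ComplexFinsler.polydiskMetric n t k) Z₁ Z₂ =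
          1 / (2 * √(1 + t)) *
            √(∑ l, Real.log ((1 + ‖(Z₂ l - Z₁ l) / (1 - conj (Z₁ l) * Z₂ l)‖) /
                  (1 - ‖(Z₂ l - Z₁ l) / (1 - conj (Z₁ l) * Z₂ l)‖)) ^ 2 +
              t * (∑ l, Real.log ((1 + ‖(Z₂ l - Z₁ l) / (1 - conj (Z₁ l) * Z₂ l)‖) /
                  (1 - ‖(Z₂ l - Z₁ l) / (1 - conj (Z₁ l) * Z₂ l)‖)) ^ (2 * k)) ^
                ((1 : ℝ) / k))) := by
  refine ⟨⟨ComplexFinsler.isAutInvariant_polydiskMetric ht k,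
    ComplexFinsler.isFinslerComplete_polydiskMetric ht hk,
    ComplexFinsler.isStronglyConvex_polydiskMetric ht hk,
    ComplexFinsler.isKahlerBerwald_polydiskMetric ht hk,
    fun z hz v hv => ComplexFinsler.holSectCurvature_mem_Icc ht hk hz hv⟩,
    fun I hI hI' γ =>
      ComplexFinsler.isGeodesicOn_polydiskMetric_iff_bergmanMetric ht hk hI hI' γ,
    fun Z₁ hZ₁ Z₂ hZ₂ => ?_⟩
  rw [ComplexFinsler.finslerDist_polydiskMetric ht hk hZ₁ hZ₂,
    ComplexFinsler.polydiskDist_eq ht hk]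
  rfl
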